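/- **Strength of the potential equations of the electromagnetic field and of two difference schemes.** Let $K$ be a field of characteristic $0$. With four operators $d_1,\dots,d_4$ and four unknowns $\psi_1,\dots,\psi_4$, consider the system $$(\ast)\qquad \sum_{j=1}^4 d_j\psi_j=0,\qquad \sum_{j=1}^4\bigl(d_j^2\psi_i-d_id_j\psi_j\bigr)=0\quad(i=1,\dots,4).$$ *Dimension polynomials.* (a) If $\delta_1,\dots,\delta_4$ are commuting derivations of $K$, let $F$ be the free left module on $e_1,\dots,e_4$ over the ring $K[\Delta]$ of differential operators ($\delta_j a=a\delta_j+\delta_j(a)$); it has the $K$-basis of terms $\delta_1^{k_1}\cdots\delta_4^{k_4}e_i$, $k_j\in\mathbb N$. (b) If $\delta_1,\dots,\delta_4$ are commuting automorphisms of $K$, let $F$ be the free left module on $e_1,\dots,e_4$ over the ring $K[\Delta^*]$ of inversive difference operators ($\delta_j^{\pm1}a=\delta_j^{\pm1}(a)\delta_j^{\pm1}$); it has the $K$-basis of terms $\delta_1^{k_1}\cdots\delta_4^{k_4}e_i$, $k_j\in\mathbb Z$. The order of a term is $\sum_j|k_j|$. For a linear system, let $N\subseteq F$ be the submodule generated by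 its left-hand sides (with $\psi_i=e_i$), let $M=F/N$, and let $M_r$ be the $K$-span of the images of all terms of order $\le r$. Likewise let $R$ be the ring of differential (inversive difference) polynomials over $K$ in $y_1,\dots,y_4$, let $P$ be the differential (reflexive difference) ideal generated by the left-hand sides (with $\psi_i=y_i$), and let $R_r\subseteq R$ be the polynomial ring over $K$ in the indeterminates $\delta_1^{k_1}\cdots\delta_4^{k_4}y_i$ of order $\le r$. A polynomial $\phi\in\mathbb Q[r]$ is called the dimension polynomial of the system if the system is prime, that is, $P$ is a prime ideal, and $$\phi(r)=\dim_K M_r=\operatorname{trdeg}_K\bigl(R_r/(P\cap R_r)\bigr)\quad\text{for all sufficiently large } r\in\mathbb N.$$ Then: 1. For all commuting derivations $\delta_1,\dots,\delta_4$ of $K$, the differential dimension polynomial of $(\ast)$ with $d_j=\delta_j$ (so $d_j=\partial/\partial x_j$) is $$r^3+\tfrac{11}{2}r^2+\tfrac{17}{2}r+4.$$ For all commuting automorphisms $\delta_1,\dots,\delta_4$ of $K$ (for instance the shifts $x_j\mapsto x_j+1$): 2. the difference dimension polynomial of the forward difference scheme, that is, of $(\ast)$ with $d_j=\delta_j-1$,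 is $$15r^3-\tfrac72r^2+\tfrac{43}{2}r+2;$$ 3. the difference dimension polynomial of the symmetric difference scheme, that is, of $(\ast)$ with $d_j=\tfrac12(\delta_j-\delta_j^{-1})$, is $$16r^3-8r^2+24r+8;$$ 4. the forward scheme has higher strength than the symmetric scheme (and is in this sense preferable): its dimension polynomial is smaller than that of the symmetric scheme for all sufficiently large $r$. -/

import Mathlib

namespace PotentialStrength

noncomputable section

open Filter

/-! ### Numerical data: dimension polynomials and strength -/

/-- `φ ∈ ℚ[t]` is the dimension polynomial of a sequence of dimensions (or transcendence degrees)
`f`: for all sufficiently large `r`, the cardinal `f r` is finite and equal to `φ(r)`. -/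
def IsDimensionPolynomial (f : ℕ → Cardinal) (φ : Polynomial ℚ) : Prop :=
  ∀ᶠ r : ℕ in atTop, ∃ n : ℕ, f r = n ∧ (n : ℚ) = φ.eval (r : ℚ)

/-- A system with dimension polynomial `φ` has higher strength than (is preferable to) a system
with dimension polynomial `ψ` if `φ(r) < ψ(r)` for all sufficiently large `r`. -/
def HasHigherStrength (φ ψ : Polynomial ℚ) : Prop :=
  ∀ᶠ r : ℕ in atTop, φ.eval (r : ℚ) < ψ.eval (r : ℚ)

/-! ### Terms `θ e_i` and their orders -/

/-- Terms `θ e_i` with `θ = δ₁^{k₁} ⋯ δ_m^{k_m}`, `k_j ∈ ℕ`, and `1 ≤ i ≤ s`. -/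
abbrev Term (m s : ℕ) : Type := Fin s × (Fin m → ℕ)

/-- Terms `γ e_i` with `γ = δ₁^{k₁} ⋯ δ_m^{k_m}`, `k_j ∈ ℤ`, and `1 ≤ i ≤ s`. -/
abbrev InvTerm (m s : ℕ) : Type := Fin s × (Fin m → ℤ)

/-- `ord (δ₁^{k₁} ⋯ δ_m^{k_m} e_i) = k₁ + ⋯ + k_m`. -/
def Term.ord {m s : ℕ} (t : Term m s) : ℕ := ∑ j, t.2 j

/-- `ord (δ₁^{k₁} ⋯ δ_m^{k_m} e_i) = |k₁| + ⋯ + |k_m|`. -/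
def InvTerm.ord {m s : ℕ} (t : InvTerm m s) : ℕ := ∑ j, (t.2 j).natAbs

/-- The term `δ_j θ e_i`. -/
def Term.shift {m s : ℕ} (j : Fin m) (t : Term m s) : Term m s := (t.1, t.2 + Pi.single j 1)

/-- The term `δ_j^z γ e_i`. -/
def InvTerm.shift {m s : ℕ} (j : Fin m) (z : ℤ) (t : InvTerm m s) : InvTerm m s :=
  (t.1, t.2 + Pi.single j z)

section Operators

variable {K : Type*} [Field K] {m : ℕ} (s : ℕ)

/-! ### Free modules of differential and of inversive difference operators

The free left `K[Δ]`-module on `e_1, …, e_s` is the `K`-vector space with basis all terms `θ e_i`,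
on which `δ_j` acts by `δ_j (a θ e_i) = δ_j(a) θ e_i + a (δ_j θ) e_i`; the free left
`K[Δ*]`-module is the `K`-vector space with basis all terms `γ e_i`, on which
`δ_j^{±1} (a γ e_i) = δ_j^{±1}(a) (δ_j^{±1} γ) e_i`. A `K[Δ]`-submodule (`K[Δ*]`-submodule) is a
`K`-subspace that is stable under the `δ_j` (under the `δ_j` and the `δ_j⁻¹`). -/

/-- The action of `δ_j` on the free differential module. -/
def freeDer (δ : Fin m → Derivation ℤ K K) (j : Fin m) : (Term m s →₀ K) →+ (Term m s →₀ K) :=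
  Finsupp.mapRange.addMonoidHom ((δ j : Derivation ℤ K K) : K →+ K) +
    Finsupp.mapDomain.addMonoidHom (Term.shift j)

/-- The action of `δ_j` on the free inversive difference module. -/
def freeTrans (σ : Fin m → K ≃+* K) (j : Fin m) : (InvTerm m s →₀ K) →+ (InvTerm m s →₀ K) :=
  (Finsupp.mapDomain.addMonoidHom (InvTerm.shift j 1)).comp
    (Finsupp.mapRange.addMonoidHom ((σ j : K ≃+* K) : K →+ K))

/-- The action of `δ_j⁻¹` on the free inversive difference module. -/
def freeTransInv (σ : Fin m → K ≃+* K) (j : Fin m) : (InvTerm m s →₀ K) →+ (InvTerm m s →₀ K) :=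
  (Finsupp.mapDomain.addMonoidHom (InvTerm.shift j (-1))).comp
    (Finsupp.mapRange.addMonoidHom ((σ j).symm : K →+ K))

/-! ### Rings of differential and of inversive difference polynomials

`K{y_1, …, y_s}` is the polynomial ring over `K` in the indeterminates `θ y_i`, with
`δ_j (θ y_i) = (δ_j θ) y_i` and `δ_j` extending the given operator of `K`; similarly for
`K{y_1, …, y_s}*` with the indeterminates `γ y_i`. -/

/-- The additive map on a polynomial ring over `K` that applies a derivation to the
coefficients. -/
def coeffDer {τ : Type} (D : Derivation ℤ K K) : MvPolynomial τ K →+ MvPolynomial τ K where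
  toFun f := AddMonoidAlgebra.map (D : K →+ K) f
  map_zero' := by
    ext u
    exact map_zero D
  map_add' f g := by
    ext u
    exact map_add D (MvPolynomial.coeff u f) (MvPolynomial.coeff u g)

/-- The derivation `δ_j` of `K{y_1, …, y_s}`: the sum of the derivation that acts on coefficients
only and of the `K`-linear derivation that sends `θ y_i` to `(δ_j θ) y_i`. -/
def polyDer (δ : Fin m → Derivation ℤ K K) (j : Fin m) :
    MvPolynomial (Term m s) K →+ MvPolynomial (Term m s) K :=
  coeffDer (δ j) + (MvPolynomial.mkDerivation K
    (fun t : Term m s => (MvPolynomial.X (Term.shift j t) :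
      MvPolynomial (Term m s) K))).toLinearMap.toAddMonoidHom

/-- The automorphism `δ_j` of `K{y_1, …, y_s}*`. -/
def polyTrans (σ : Fin m → K ≃+* K) (j : Fin m) :
    MvPolynomial (InvTerm m s) K →+ MvPolynomial (InvTerm m s) K :=
  ((MvPolynomial.rename (InvTerm.shift j 1)).toRingHom.comp
    (MvPolynomial.map ((σ j : K ≃+* K) : K →+* K))).toAddMonoidHom

/-- The automorphism `δ_j⁻¹` of `K{y_1, …, y_s}*`. -/
def polyTransInv (σ : Fin m → K ≃+* K) (j : Fin m) :
    MvPolynomial (InvTerm m s) K →+ MvPolynomial (InvTerm m s) K :=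
  ((MvPolynomial.rename (InvTerm.shift j (-1))).toRingHom.comp
    (MvPolynomial.map ((σ j).symm : K →+* K))).toAddMonoidHom

end Operators

section Generated

variable {K : Type*} [Field K] {τ : Type} {ι : Type}

/-- The smallest `K`-subspace that contains `S` and is stable under all operators `T i`. -/
def stableSpan (T : ι → (τ →₀ K) →+ (τ →₀ K)) (S : Set (τ →₀ K)) : Submodule K (τ →₀ K) :=
  sInf {N | S ⊆ N ∧ ∀ i, ∀ x ∈ N, T i x ∈ N}

/-- The smallest ideal that contains `S` and is stable under all operators `T i`. -/
def stableIdeal (T : ι → MvPolynomial τ K →+ MvPolynomial τ K) (S : Set (MvPolynomial τ K)) :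
    Ideal (MvPolynomial τ K) :=
  sInf {I | S ⊆ I ∧ ∀ i, ∀ x ∈ I, T i x ∈ I}

/-- For `M = F / N`, with `F` free with basis the terms: `dim_K M_r`, where `M_r` is the `K`-span
of the images of the terms of order at most `r`. -/
def filtrationDim (ord : τ → ℕ) (N : Submodule K (τ →₀ K)) (r : ℕ) : Cardinal :=
  Module.rank K
    ((Submodule.span K {x | ∃ t, ord t ≤ r ∧ x = Finsupp.single t (1 : K)}).map N.mkQ)

/-- `trdeg_K (R_r / (P ∩ R_r))`, where `R_r` is the polynomial ring in the indeterminates of order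
at most `r`. -/
def filtrationTrdeg (ord : τ → ℕ) (P : Ideal (MvPolynomial τ K)) (r : ℕ) : Cardinal :=
  Algebra.trdeg K
    (MvPolynomial.supported K {t | ord t ≤ r} ⧸
      P.comap (MvPolynomial.supported K {t | ord t ≤ r}).val)

end Generated

/-! ### The potential equations -/

/-- The left-hand sides of the potential equations `∑_j d_j ψ_j = 0` and
`∑_j (d_j² ψ_i - d_i d_j ψ_j) = 0` (`i = 1, …, 4`), written with four operators `d_j` (partial
derivatives or difference quotients) and four unknowns `ψ_i`. -/
def potentialEquations {A : Type*} [AddCommGroup A] (d : Fin 4 → A →+ A) (ψ : Fin 4 → A) :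
    Set A :=
  {∑ j, d j (ψ j)} ∪ Set.range fun i => ∑ j, (d j (d j (ψ i)) - d i (d j (ψ j)))

/-- Forward differences: `∂/∂x_j` is replaced by `δ_j - 1`. -/
def forwardDifference {A : Type*} [AddCommGroup A] (D : Fin 4 → A →+ A) (j : Fin 4) : A →+ A :=
  D j - AddMonoidHom.id A

/-- Symmetric differences: `∂/∂x_j` is replaced by `(δ_j - δ_j⁻¹) / 2`. -/
def symmetricDifference (K : Type*) {A : Type*} [Field K] [AddCommGroup A] [Module K A]
    (D Dinv : Fin 4 → A →+ A) (j : Fin 4) : A →+ A :=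
  (2⁻¹ : K) • (D j - Dinv j)

section Systems

variable {K : Type*} [Field K]

/-- The free generators `e_1, …, e_4` of the free differential module. -/
def e (K : Type*) [Field K] (i : Fin 4) : Term 4 4 →₀ K := Finsupp.single (i, 0) 1

/-- The free generators `e_1, …, e_4` of the free inversive difference module. -/
def eInv (K : Type*) [Field K] (i : Fin 4) : InvTerm 4 4 →₀ K := Finsupp.single (i, 0) 1

/-- The differential indeterminates `y_1, …, y_4`. -/
def y (K : Type*) [Field K] (i : Fin 4) : MvPolynomial (Term 4 4) K := MvPolynomial.X (i, 0)

/-- The inversive difference indeterminates `y_1, …, y_4`. -/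
def yInv (K : Type*) [Field K] (i : Fin 4) : MvPolynomial (InvTerm 4 4) K := MvPolynomial.X (i, 0)

/-- The `K[Δ]`-submodule `N` generated by the potential equations. -/
def differentialSubmodule (δ : Fin 4 → Derivation ℤ K K) : Submodule K (Term 4 4 →₀ K) :=
  stableSpan (freeDer 4 δ) (potentialEquations (freeDer 4 δ) (e K))

/-- The `Δ`-ideal of `K{y_1, …, y_4}` generated by the potential equations. -/
def differentialIdeal (δ : Fin 4 → Derivation ℤ K K) : Ideal (MvPolynomial (Term 4 4) K) :=
  stableIdeal (polyDer 4 δ) (potentialEquations (polyDer 4 δ) (y K))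

/-- The `K[Δ*]`-submodule `N` generated by the forward difference scheme. -/
def forwardSubmodule (σ : Fin 4 → K ≃+* K) : Submodule K (InvTerm 4 4 →₀ K) :=
  stableSpan (Sum.elim (freeTrans 4 σ) (freeTransInv 4 σ))
    (potentialEquations (forwardDifference (freeTrans 4 σ)) (eInv K))

/-- The `Δ*`-ideal of `K{y_1, …, y_4}*` generated by the forward difference scheme. -/
def forwardIdeal (σ : Fin 4 → K ≃+* K) : Ideal (MvPolynomial (InvTerm 4 4) K) :=
  stableIdeal (Sum.elim (polyTrans 4 σ) (polyTransInv 4 σ))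
    (potentialEquations (forwardDifference (polyTrans 4 σ)) (yInv K))

/-- The `K[Δ*]`-submodule `N` generated by the symmetric difference scheme. -/
def symmetricSubmodule (σ : Fin 4 → K ≃+* K) : Submodule K (InvTerm 4 4 →₀ K) :=
  stableSpan (Sum.elim (freeTrans 4 σ) (freeTransInv 4 σ))
    (potentialEquations (symmetricDifference K (freeTrans 4 σ) (freeTransInv 4 σ)) (eInv K))

/-- The `Δ*`-ideal of `K{y_1, …, y_4}*` generated by the symmetric difference scheme. -/
def symmetricIdeal (σ : Fin 4 → K ≃+* K) : Ideal (MvPolynomial (InvTerm 4 4) K) :=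
  stableIdeal (Sum.elim (polyTrans 4 σ) (polyTransInv 4 σ))
    (potentialEquations (symmetricDifference K (polyTrans 4 σ) (polyTransInv 4 σ)) (yInv K))

/-- `φ` is the dimension polynomial of a linear system: it is the dimension polynomial of the
module `F / N` with its standard filtration; moreover the system is prime and `φ` is the dimension
polynomial `trdeg_K (R_r / (P ∩ R_r))` of the system of algebraic equations. -/
structure IsDimensionPolynomialOfSystem {τ : Type} (ord : τ → ℕ) (N : Submodule K (τ →₀ K))
    (P : Ideal (MvPolynomial τ K)) (φ : Polynomial ℚ) : Prop where
  dim : IsDimensionPolynomial (filtrationDim ord N) φ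
  prime : P.IsPrime
  trdeg : IsDimensionPolynomial (filtrationTrdeg ord P) φ

end Systems

/-- `r³ + (11/2) r² + (17/2) r + 4`. -/
def differentialPolynomial : Polynomial ℚ :=
  .X ^ 3 + .C (11 / 2) * .X ^ 2 + .C (17 / 2) * .X + 4

/-- `15 r³ - (7/2) r² + (43/2) r + 2`. -/
def forwardPolynomial : Polynomial ℚ :=
  15 * .X ^ 3 - .C (7 / 2) * .X ^ 2 + .C (43 / 2) * .X + 2

/-- `16 r³ - 8 r² + 24 r + 8`. -/
def symmetricPolynomial : Polynomial ℚ :=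
  16 * .X ^ 3 - 8 * .X ^ 2 + 24 * .X + 8

end

end PotentialStrength

/-! The symbols `D_j` of the operators, namely `δ_j`, `δ_j - 1` and `(δ_j - δ_j⁻¹)/2`, have
coefficients in the prime field, which derivations of `K` kill and automorphisms fix. So `N` is the
same `K`-subspace as for constant coefficients. Put `□ = ∑ D_j²` and `w = ∑ D_i e_i`. The `i`-th
equation of second order is `□ e_i - D_i w`, hence `N` consists of all `f w + ∑ f_i □ e_i` with `f`,
`f_i` in a commutative monoid algebra (`stableSpan_potentialEquations`). The syzygy `□ w = ∑ D_i (□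
e_i)` (`divMap_mul_box`) makes the relations `δ^k w` redundant except when `δ^k` is not a leading
monomial of a multiple of `□` (`solModule_le_of_isReductionSystem`).

Dimensions are then found by `K`-linear elimination. If relations spanning `N` have pairwise
distinct leading terms for a well-founded weight refining the order, the terms that do not lead form
a basis of `F/N` compatible with the filtration. So `dim M_r` is the number of terms of order at
most `r` minus the number of relations whose leading term has order at most `r`
(`filtrationDim_solModule`).

Let `B(r)` be the number of exponent vectors of order at most `r`. In the differential and the
symmetric case every `δ^k □ e_i` leads in order `|k| + 2` and every needed `δ^k w` in order `|k| +
1`, which gives `4B(r) - 4B(r-2) - (B(r-1) - B(r-3))` with the respective `B`. In the forward scheme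
`□` does not raise the order of a monomial whose exponents are all negative. Moreover some `δ^k w`
collide with multiples of `□` and are replaced by relations leading in order `|k|` (`fwdRel`). These
additional relations of low order lower the dimension polynomial.

Finally `P` is generated by the linear forms in `N`, so `R/P` is a polynomial ring on a basis of
`F/N`. Thus `P` is prime, and a basis adapted to `M_r` identifies the transcendence degree with `dim
M_r` (`filtrationTrdeg_span_linForm`). -/

namespace PotentialStrength

open Filter

/-! ### Reduction systems -/

section Reduction

variable {K T I Λ : Type*} [Field K] [LinearOrder Λ]

/-- A family of relations `rel i` with distinct leading terms `lm i`, where terms are compared by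
means of `μ`. -/
structure IsReductionSystem (μ : T → Λ) (rel : I → T →₀ K) (lm : I → T) : Prop where
  inj : Function.Injective lm
  coeff_ne : ∀ i, rel i (lm i) ≠ 0
  lt : ∀ i t, rel i t ≠ 0 → t ≠ lm i → μ t < μ (lm i)

variable {μ : T → Λ} {rel : I → T →₀ K} {lm : I → T}

/-- Existence of normal forms: a leading term is replaced by the smaller terms of its relation, and
this stops because the weights are well-founded. The bound on the weights keeps the reduction within
the filtration. -/
theorem IsReductionSystem.single_mem [WellFoundedLT Λ] (h : IsReductionSystem μ rel lm) (t : T) :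
    Finsupp.single t (1 : K) ∈ Submodule.span K (Set.range rel) ⊔
      Submodule.span K {x | ∃ t', t' ∉ Set.range lm ∧ μ t' ≤ μ t ∧ x = Finsupp.single t' 1} := by
  classical
  induction hm : μ t using WellFoundedLT.induction generalizing t with
  | ind m ih =>
  by_cases ht : t ∈ Set.range lm
  · obtain ⟨i, rfl⟩ := ht
    have key : Finsupp.single (lm i) (1 : K) =
        (rel i (lm i))⁻¹ • rel i - (rel i (lm i))⁻¹ • (rel i).erase (lm i) := by
      rw [← smul_sub]
      nth_rewrite 2 [← Finsupp.single_add_erase (lm i) (rel i)]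
      rw [add_sub_cancel_right, Finsupp.smul_single, smul_eq_mul, inv_mul_cancel₀ (h.coeff_ne i)]
    rw [key]
    refine Submodule.sub_mem _ (Submodule.smul_mem _ _ (Submodule.mem_sup_left
      (Submodule.subset_span ⟨i, rfl⟩))) (Submodule.smul_mem _ _ ?_)
    rw [← Finsupp.sum_single ((rel i).erase (lm i))]
    refine Submodule.sum_mem _ fun t ht => ?_
    rw [Finsupp.support_erase, Finset.mem_erase, Finsupp.mem_support_iff] at ht
    have hlt : μ t < m := hm ▸ h.lt i t ht.2 ht.1
    have h1 := ih _ hlt t rfl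
    rw [← mul_one ((rel i).erase (lm i) t), ← smul_eq_mul, ← Finsupp.smul_single]
    refine Submodule.smul_mem _ _ ((sup_le_sup_left (Submodule.span_mono ?_) _ :
      _ ≤ Submodule.span K (Set.range rel) ⊔ _) h1)
    rintro x ⟨t', h2, h3, h4⟩
    exact ⟨t', h2, h3.trans hlt.le, h4⟩
  · exact Submodule.mem_sup_right (Submodule.subset_span ⟨t, ht, hm.le, rfl⟩)

/-- Uniqueness of normal forms. In a nontrivial combination of relations, the greatest leading term
occurs in no other relation involved, so it cannot cancel. No confluence check is needed, since all
relations, not only module generators, are listed with distinct leading terms. -/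
theorem IsReductionSystem.eq_zero_of_mem_span (h : IsReductionSystem μ rel lm) {x : T →₀ K}
    (hx : x ∈ Submodule.span K (Set.range rel)) (h0 : ∀ i, x (lm i) = 0) : x = 0 := by
  obtain ⟨c, rfl⟩ := (Finsupp.mem_span_range_iff_exists_finsupp).1 hx
  by_contra hne
  have hc : c.support.Nonempty := by
    rw [Finsupp.support_nonempty_iff]
    rintro rfl
    simp at hne
  obtain ⟨i, hi, hmax⟩ := c.support.exists_max_image (fun i => μ (lm i)) hc
  have h1 := h0 i
  rw [Finsupp.sum, Finsupp.finsetSum_apply, Finset.sum_eq_single i] at h1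
  · rw [Finsupp.smul_apply, smul_eq_mul, mul_eq_zero] at h1
    exact h1.elim (Finsupp.mem_support_iff.1 hi) (h.coeff_ne i)
  · intro j hj hji
    by_contra h2
    rw [Finsupp.smul_apply, smul_eq_mul, mul_eq_zero, not_or] at h2
    exact absurd (h.lt j (lm i) h2.2 fun h3 => hji (h.inj h3).symm) (not_lt.2 (hmax j hj))
  · exact fun h2 => absurd hi h2

end Reduction

theorem ncard_notMem_range_add {T I : Type*} {ord : T → ℕ} {lm : I → T}
    (hlm : Function.Injective lm) (hfin : ∀ r, {t | ord t ≤ r}.Finite) (r : ℕ) :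
    {t | ord t ≤ r ∧ t ∉ Set.range lm}.ncard + {i | ord (lm i) ≤ r}.ncard =
      {t | ord t ≤ r}.ncard := by
  have h1 : {i | ord (lm i) ≤ r}.ncard = (lm '' {i | ord (lm i) ≤ r}).ncard :=
    (Set.ncard_image_of_injective _ hlm).symm
  have h2 : {t | ord t ≤ r} = {t | ord t ≤ r ∧ t ∉ Set.range lm} ∪ lm '' {i | ord (lm i) ≤ r} := by
    ext t
    simp only [Set.mem_ofPred_eq, Set.mem_union, Set.mem_image, Set.mem_range]
    constructor
    · intro ht
      by_cases h3 : ∃ i, lm i = t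
      · obtain ⟨i, rfl⟩ := h3
        exact Or.inr ⟨i, ht, rfl⟩
      · exact Or.inl ⟨ht, h3⟩
    · rintro (h3 | ⟨i, h3, rfl⟩)
      exacts [h3.1, h3]
  have h4 : {t | ord t ≤ r ∧ t ∉ Set.range lm}.Finite := (hfin r).subset fun t ht => ht.1
  have h5 : (lm '' {i | ord (lm i) ≤ r}).Finite := by
    refine (hfin r).subset ?_
    rintro _ ⟨i, h3, rfl⟩
    exact h3
  rw [h1, h2, Set.ncard_union_eq _ h4 h5]
  rw [Set.disjoint_left]
  rintro _ h3 ⟨i, _, rfl⟩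
  exact h3.2 ⟨i, rfl⟩
-- Dimension of the filtration as a number of normal terms
section Dimension

variable {K Λ : Type*} [Field K] [LinearOrder Λ] [WellFoundedLT Λ] {T I : Type}
  {μ : T → Λ} {rel : I → T →₀ K} {lm : I → T}

theorem IsReductionSystem.filtrationDim_eq_ncard (h : IsReductionSystem μ rel lm) {ord : T → ℕ}
    (hord : ∀ t t', μ t ≤ μ t' → ord t ≤ ord t') (hfin : ∀ r, {t | ord t ≤ r}.Finite) (r : ℕ) :
    filtrationDim ord (Submodule.span K (Set.range rel)) r =
      ({t | ord t ≤ r ∧ t ∉ Set.range lm}.ncard : Cardinal) := by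
  set N := Submodule.span K (Set.range rel)
  set B : Set T := {t | ord t ≤ r ∧ t ∉ Set.range lm}
  have hB : B.Finite := (hfin r).subset fun t ht => ht.1
  let v : B → ((T →₀ K) ⧸ N) := fun t => N.mkQ (Finsupp.single t.1 1)
  have hspan : (Submodule.span K {x | ∃ t, ord t ≤ r ∧ x = Finsupp.single t (1 : K)}).map N.mkQ =
      Submodule.span K (Set.range v) := by
    apply le_antisymm
    · rw [Submodule.map_span_le]
      rintro _ ⟨t, ht, rfl⟩
      have h1 := Submodule.mem_map_of_mem (f := N.mkQ) (h.single_mem t)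
      rw [Submodule.map_sup, Submodule.mkQ_map_self, bot_sup_eq, Submodule.map_span] at h1
      refine Submodule.span_mono ?_ h1
      rintro _ ⟨_, ⟨t', h2, h3, rfl⟩, rfl⟩
      exact ⟨⟨t', (hord _ _ h3).trans ht, h2⟩, rfl⟩
    · rw [Submodule.span_le]
      rintro _ ⟨t, rfl⟩
      exact Submodule.mem_map_of_mem (Submodule.subset_span ⟨t.1, t.2.1, rfl⟩)
  have hli : LinearIndependent K v := by
    have h1 : LinearIndependent K (fun t : B => Finsupp.single (t : T) (1 : K)) :=
      (Finsupp.basisSingleOne (R := K) (ι := T)).linearIndependent.comp _ Subtype.val_injective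
    refine h1.map (f := N.mkQ) ?_
    rw [Submodule.ker_mkQ, Submodule.disjoint_def]
    intro x hx hxN
    refine h.eq_zero_of_mem_span hxN fun i => ?_
    have h2 : x ∈ Finsupp.supported K K B := by
      rw [Finsupp.supported_eq_span_single]
      refine Submodule.span_mono ?_ hx
      rintro _ ⟨t, rfl⟩
      exact ⟨t, t.2, rfl⟩
    by_contra h3
    exact (((Finsupp.mem_supported _ _).1 h2) (Finsupp.mem_support_iff.2 h3)).2 ⟨i, rfl⟩
  have : Fintype B := hB.fintype
  have := FiniteDimensional.span_of_finite K (Set.finite_range v)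
  rw [filtrationDim, hspan, ← Module.finrank_eq_rank, finrank_span_eq_card hli,
    Set.ncard_eq_toFinset_card' B, Set.toFinset_card]

theorem IsReductionSystem.filtrationDim_eq (h : IsReductionSystem μ rel lm) {ord : T → ℕ}
    (hord : ∀ t t', μ t ≤ μ t' → ord t ≤ ord t') (hfin : ∀ r, {t | ord t ≤ r}.Finite) (r : ℕ) :
    ∃ n : ℕ, filtrationDim ord (Submodule.span K (Set.range rel)) r = n ∧
      n + {i | ord (lm i) ≤ r}.ncard = {t | ord t ≤ r}.ncard := by
  exact ⟨_, h.filtrationDim_eq_ncard hord hfin r, ncard_notMem_range_add h.inj hfin r⟩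

end Dimension

/-! ### Ideals generated by linear forms -/

section LinearIdeal

variable {K : Type*} [Field K]

/-- The linear form with given coefficients. -/
noncomputable def linForm (K : Type*) [Field K] (τ : Type*) : (τ →₀ K) →ₗ[K] MvPolynomial τ K :=
  Finsupp.linearCombination K MvPolynomial.X

theorem linForm_single {τ : Type*} (t : τ) (a : K) :
    linForm K τ (Finsupp.single t a) = a • MvPolynomial.X t :=
  Finsupp.linearCombination_single ..

/-- Substituting into the indeterminates their classes modulo `N`, written in the basis `b`. -/
noncomputable def quotSubst {τ ι : Type*} (N : Submodule K (τ →₀ K))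
    (b : Module.Basis ι K ((τ →₀ K) ⧸ N)) : MvPolynomial τ K →ₐ[K] MvPolynomial ι K :=
  MvPolynomial.aeval fun t => linForm K ι (b.repr (N.mkQ (Finsupp.single t 1)))

theorem quotSubst_linForm {τ ι : Type*} (N : Submodule K (τ →₀ K))
    (b : Module.Basis ι K ((τ →₀ K) ⧸ N)) (x : τ →₀ K) :
    quotSubst N b (linForm K τ x) = linForm K ι (b.repr (N.mkQ x)) := by
  suffices (quotSubst N b).toLinearMap ∘ₗ linForm K τ =
      linForm K ι ∘ₗ b.repr.toLinearMap ∘ₗ N.mkQ from LinearMap.congr_fun this x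
  ext t
  simp [linForm_single, quotSubst]

/-- The substitution is the quotient by the linear forms in `N`: a linear section of `F → F/N` gives
a substitution back, and the composite changes each indeterminate only by a linear form in `N`. -/
theorem ker_quotSubst {τ ι : Type*} (N : Submodule K (τ →₀ K))
    (b : Module.Basis ι K ((τ →₀ K) ⧸ N)) :
    RingHom.ker (quotSubst N b) = Ideal.span (linForm K τ '' N) := by
  apply le_antisymm
  · obtain ⟨S, hS⟩ := N.mkQ.exists_rightInverse_of_surjective N.range_mkQ
    let Ψ : MvPolynomial ι K →ₐ[K] MvPolynomial τ K :=
      MvPolynomial.aeval fun i => linForm K τ (S (b i))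
    have hΨ : Ψ.toLinearMap ∘ₗ linForm K ι ∘ₗ b.repr.toLinearMap = linForm K τ ∘ₗ S :=
      b.ext fun i => by simp [Ψ, linForm_single]
    have hcomp : ((Ideal.Quotient.mkₐ K (Ideal.span (linForm K τ '' N))).comp Ψ).comp
        (quotSubst N b) = Ideal.Quotient.mkₐ K (Ideal.span (linForm K τ '' N)) := by
      refine MvPolynomial.algHom_ext fun t => ?_
      have h1 : quotSubst N b (MvPolynomial.X t) =
          linForm K ι (b.repr (N.mkQ (Finsupp.single t 1))) := by
        simp [quotSubst]
      have h2 := LinearMap.congr_fun hΨ (N.mkQ (Finsupp.single t 1))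
      simp only [LinearMap.comp_apply, AlgHom.toLinearMap_apply, LinearEquiv.coe_coe] at h2
      rw [AlgHom.comp_apply, AlgHom.comp_apply, h1, h2, Ideal.Quotient.mkₐ_eq_mk,
        Ideal.Quotient.eq]
      have h3 : (MvPolynomial.X t : MvPolynomial τ K) = linForm K τ (Finsupp.single t 1) := by
        rw [linForm_single, one_smul]
      rw [h3, ← map_sub]
      refine Ideal.subset_span ⟨_, ?_, rfl⟩
      have h4 := LinearMap.congr_fun hS (N.mkQ (Finsupp.single t 1))
      rw [SetLike.mem_coe, ← Submodule.Quotient.mk_eq_zero, Submodule.Quotient.mk_sub, sub_eq_zero]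
      exact h4
    intro p hp
    rw [RingHom.mem_ker] at hp
    have h1 := DFunLike.congr_fun hcomp p
    rw [AlgHom.comp_apply, hp, map_zero] at h1
    exact Ideal.Quotient.eq_zero_iff_mem.1 h1.symm
  · rw [Ideal.span_le]
    rintro _ ⟨x, hx, rfl⟩
    rw [SetLike.mem_coe, RingHom.mem_ker, quotSubst_linForm]
    have : N.mkQ x = 0 := by rwa [← LinearMap.mem_ker, Submodule.ker_mkQ]
    rw [this, map_zero, map_zero]

theorem isPrime_span_linForm {τ : Type*} (N : Submodule K (τ →₀ K)) :
    (Ideal.span (linForm K τ '' N)).IsPrime := by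
  rw [← ker_quotSubst N (Module.Basis.ofVectorSpace K _)]
  exact RingHom.ker_isPrime _

theorem linForm_comp_mapDomain {ι κ : Type*} (f : ι → κ) (x : ι →₀ K) :
    linForm K κ (Finsupp.mapDomain f x) = MvPolynomial.rename f (linForm K ι x) := by
  induction x using Finsupp.induction_linear with
  | zero => simp
  | add x y hx hy => rw [Finsupp.mapDomain_add, map_add, map_add, map_add, hx, hy]
  | single i a => rw [Finsupp.mapDomain_single, linForm_single, linForm_single, map_smul,
      MvPolynomial.rename_X]

/-- A basis of `M_r` is extended to one of `F/N`. After substitution, the indeterminates of order at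
most `r` generate exactly the polynomial ring on the basis of `M_r`. -/
theorem filtrationTrdeg_span_linForm {τ : Type} (ord : τ → ℕ) (N : Submodule K (τ →₀ K)) (r : ℕ) :
    filtrationTrdeg ord (Ideal.span (linForm K τ '' N)) r = filtrationDim ord N r := by
  set W := (Submodule.span K {x | ∃ t, ord t ≤ r ∧ x = Finsupp.single t (1 : K)}).map N.mkQ with hW
  obtain ⟨W', hc⟩ := Submodule.exists_isCompl W
  let b₁ := Module.Basis.ofVectorSpace K W
  let b := (b₁.prod (Module.Basis.ofVectorSpace K W')).map (Submodule.prodEquivOfIsCompl W W' hc)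
  have hb : ∀ w : W, b.repr (w : (τ →₀ K) ⧸ N) = Finsupp.mapDomain Sum.inl (b₁.repr w) := by
    intro w
    have h1 : b.repr.toLinearMap ∘ₗ W.subtype =
        Finsupp.lmapDomain K K Sum.inl ∘ₗ b₁.repr.toLinearMap := by
      refine b₁.ext fun i => ?_
      have h2 : ((b₁ i : W) : (τ →₀ K) ⧸ N) = b (Sum.inl i) := by
        simp [b]
      simp only [LinearMap.comp_apply, Submodule.subtype_apply, h2, LinearEquiv.coe_coe,
        Module.Basis.repr_self, Finsupp.lmapDomain_apply, Finsupp.mapDomain_single]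
    exact LinearMap.congr_fun h1 w
  set S : Set τ := {t | ord t ≤ r}
  let Φ := (quotSubst N b).comp (MvPolynomial.supported K S).val
  have hker : (Ideal.span (linForm K τ '' N)).comap (MvPolynomial.supported K S).val =
      RingHom.ker Φ := by
    rw [← ker_quotSubst N b]
    rfl
  have hmem : ∀ t ∈ S, N.mkQ (Finsupp.single t 1) ∈ W := fun t ht =>
    Submodule.mem_map_of_mem (Submodule.subset_span ⟨t, ht, rfl⟩)
  let ρ : MvPolynomial _ K →ₐ[K] MvPolynomial _ K := MvPolynomial.rename (R := K)
    (Sum.inl : _ → (Module.Basis.ofVectorSpaceIndex K W) ⊕ (Module.Basis.ofVectorSpaceIndex K W'))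
  have hrange : Φ.range = ρ.range := by
    have h1 : Φ.range = (MvPolynomial.supported K S).map (quotSubst N b) := by
      rw [AlgHom.range_comp, Subalgebra.range_val]
    apply le_antisymm
    · rw [h1, MvPolynomial.supported, AlgHom.map_adjoin, Algebra.adjoin_le_iff]
      rintro _ ⟨_, ⟨t, ht, rfl⟩, rfl⟩
      refine ⟨linForm K _ (b₁.repr ⟨_, hmem t ht⟩), ?_⟩
      have h2 := hb ⟨_, hmem t ht⟩
      simp only [quotSubst, MvPolynomial.aeval_X]
      rw [h2, linForm_comp_mapDomain]
      rfl
    · rw [← Algebra.map_top, ← MvPolynomial.adjoin_range_X, AlgHom.map_adjoin,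
        Algebra.adjoin_le_iff]
      rintro _ ⟨_, ⟨i, rfl⟩, rfl⟩
      obtain ⟨x, hx, hxi⟩ := Submodule.mem_map.1 (b₁ i).2
      have h3 : ρ (MvPolynomial.X i) = quotSubst N b (linForm K τ x) := by
        rw [quotSubst_linForm, hxi, hb, Module.Basis.repr_self, Finsupp.mapDomain_single,
          linForm_single, one_smul]
        exact MvPolynomial.rename_X _ _
      rw [SetLike.mem_coe, h1, h3]
      refine ⟨_, ?_, rfl⟩
      -- A basis vector of `M_r` lifts to a combination of terms of order at most `r`, whose linear
      -- form lies in `R_r`.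
      have h4 : Submodule.span K {x | ∃ t, ord t ≤ r ∧ x = Finsupp.single t (1 : K)} ≤
          (Subalgebra.toSubmodule (MvPolynomial.supported K S)).comap (linForm K τ) := by
        rw [Submodule.span_le]
        rintro _ ⟨t, ht, rfl⟩
        rw [SetLike.mem_coe, Submodule.mem_comap, linForm_single, one_smul]
        exact MvPolynomial.X_mem_supported.2 ht
      exact h4 hx
  have hinj : Function.Injective ρ := MvPolynomial.rename_injective _ Sum.inl_injective
  have e : (MvPolynomial.supported K S ⧸
      (Ideal.span (linForm K τ '' N)).comap (MvPolynomial.supported K S).val) ≃ₐ[K]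
      MvPolynomial (Module.Basis.ofVectorSpaceIndex K W) K :=
    (Ideal.quotientEquivAlgOfEq K hker).trans ((Ideal.quotientKerEquivRange Φ).trans
      ((Subalgebra.equivOfEq _ _ hrange).trans (AlgEquiv.ofInjective ρ hinj).symm))
  rw [filtrationTrdeg, filtrationDim, e.trdeg_eq, MvPolynomial.trdeg_of_isDomain,
    Cardinal.lift_id, ← hW, ← b₁.mk_eq_rank'']

end LinearIdeal

/-! ### Criteria for reduction systems -/

section ReductionCriteria

variable {K T Λ : Type*} [Field K] [LinearOrder Λ] {μ : T → Λ}

theorem IsReductionSystem.of_sub_mem {I : Type*} {rel : I → T →₀ K} {lm : I → T}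
    (inj : Function.Injective lm)
    (h : ∀ i, ∃ c : K, c ≠ 0 ∧
      rel i - Finsupp.single (lm i) c ∈ Finsupp.supported K K {t | μ t < μ (lm i)}) :
    IsReductionSystem μ rel lm := by
  classical
  refine ⟨inj, fun i => ?_, fun i t ht hne => ?_⟩
  · obtain ⟨c, hc, hi⟩ := h i
    have h1 := (Finsupp.mem_supported' _ _).1 hi (lm i) (lt_irrefl (μ (lm i)))
    rw [Finsupp.sub_apply, Finsupp.single_eq_same, sub_eq_zero] at h1
    rwa [h1]
  · obtain ⟨c, hc, hi⟩ := h i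
    by_contra hlt
    have h1 := (Finsupp.mem_supported' _ _).1 hi t hlt
    rw [Finsupp.sub_apply, Finsupp.single_eq_of_ne hne, sub_zero] at h1
    exact ht h1

theorem IsReductionSystem.sumElim {I J : Type*} {rel : I → T →₀ K} {lm : I → T}
    {rel' : J → T →₀ K} {lm' : J → T} (h : IsReductionSystem μ rel lm)
    (h' : IsReductionSystem μ rel' lm') (hd : ∀ i j, lm i ≠ lm' j) :
    IsReductionSystem μ (Sum.elim rel rel') (Sum.elim lm lm') where
  inj := h.inj.sumElim h'.inj hd
  coeff_ne := Sum.rec h.coeff_ne h'.coeff_ne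
  lt := Sum.rec h.lt h'.lt

theorem sum_sub_mem_of_mem {R M ι : Type*} [Ring R] [AddCommGroup M] [Module R M] [Fintype ι]
    [DecidableEq ι] {V : Submodule R M} {x : ι → M} {a : M} (j : ι) (hj : x j - a ∈ V)
    (h : ∀ i, i ≠ j → x i ∈ V) : ∑ i, x i - a ∈ V := by
  rw [← Finset.add_sum_erase _ _ (Finset.mem_univ j), add_sub_right_comm]
  exact V.add_mem hj (V.sum_mem fun i hi => h i (Finset.ne_of_mem_erase hi))

end ReductionCriteria

/-! ### The submodule generated by the potential equations with constant coefficients -/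

section Constant

variable {K : Type*} [Field K] {G : Type}

/-- The monomial with exponent `k`. -/
noncomputable abbrev mon (K : Type*) [Field K] {G : Type} (k : G) : AddMonoidAlgebra K G :=
  AddMonoidAlgebra.single k 1

/-- The inclusion of the `i`-th direct summand, `f ↦ f e_i`. -/
noncomputable def comp (i : Fin 4) : AddMonoidAlgebra K G →ₗ[K] (Fin 4 × G →₀ K) :=
  Finsupp.lmapDomain K K (Prod.mk i) ∘ₗ
    (AddMonoidAlgebra.coeffLinearEquiv K).toLinearMap

@[simp]
theorem comp_single (i : Fin 4) (k : G) (a : K) :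
    comp i (AddMonoidAlgebra.single k a) = Finsupp.single (i, k) a := by
  simp [comp]

theorem span_mon : Submodule.span K (Set.range (mon K (G := G))) = ⊤ := by
  rw [Submodule.eq_top_iff']
  intro f
  induction f using AddMonoidAlgebra.induction_linear with
  | zero => exact Submodule.zero_mem _
  | add f g hf hg => exact Submodule.add_mem _ hf hg
  | single k a =>
    rw [← mul_one a, ← smul_eq_mul, ← AddMonoidAlgebra.smul_single]
    exact Submodule.smul_mem _ _ (Submodule.subset_span ⟨k, rfl⟩)

variable [AddCommMonoid G]

/-- `f ↦ f ∑_i D_i e_i`. -/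
noncomputable def divMap (D : Fin 4 → AddMonoidAlgebra K G) :
    AddMonoidAlgebra K G →ₗ[K] (Fin 4 × G →₀ K) :=
  ∑ i, comp i ∘ₗ LinearMap.mulRight K (D i)

theorem divMap_apply (D : Fin 4 → AddMonoidAlgebra K G) (f : AddMonoidAlgebra K G) :
    divMap D f = ∑ i, comp i (f * D i) := by
  simp [divMap]

/-- `f ↦ f (∑_j D_j²) e_i`. -/
noncomputable def boxMap (D : Fin 4 → AddMonoidAlgebra K G) (i : Fin 4) :
    AddMonoidAlgebra K G →ₗ[K] (Fin 4 × G →₀ K) :=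
  comp i ∘ₗ LinearMap.mulRight K (∑ j, D j * D j)

theorem boxMap_apply (D : Fin 4 → AddMonoidAlgebra K G) (i : Fin 4) (f : AddMonoidAlgebra K G) :
    boxMap D i f = ∑ j, comp i (f * (D j * D j)) := by
  simp [boxMap, Finset.mul_sum]

/-- The submodule generated by `∑_i D_i e_i` and the `(∑_j D_j²) e_i`. -/
noncomputable def solModule (D : Fin 4 → AddMonoidAlgebra K G) : Submodule K (Fin 4 × G →₀ K) :=
  LinearMap.range (divMap D) ⊔ ⨆ i, LinearMap.range (boxMap D i)

variable {D : Fin 4 → AddMonoidAlgebra K G}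

theorem divMap_mem (f : AddMonoidAlgebra K G) : divMap D f ∈ solModule D :=
  Submodule.mem_sup_left ⟨f, rfl⟩

theorem boxMap_mem (i : Fin 4) (f : AddMonoidAlgebra K G) : boxMap D i f ∈ solModule D :=
  Submodule.mem_sup_right (Submodule.mem_iSup_of_mem i ⟨f, rfl⟩)

theorem solModule_le {W : Submodule K (Fin 4 × G →₀ K)} (hdiv : ∀ f, divMap D f ∈ W)
    (hbox : ∀ i f, boxMap D i f ∈ W) : solModule D ≤ W := by
  refine sup_le ?_ (iSup_le fun i => ?_)
  · rintro _ ⟨f, rfl⟩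
    exact hdiv f
  · rintro _ ⟨f, rfl⟩
    exact hbox i f

theorem divMap_mul_box (f : AddMonoidAlgebra K G) :
    divMap D (f * ∑ j, D j * D j) = ∑ i, boxMap D i (f * D i) := by
  rw [divMap_apply]
  refine Finset.sum_congr rfl fun i _ => ?_
  simp only [boxMap, LinearMap.comp_apply, LinearMap.mulRight_apply]
  congr 1
  ring

/-- This is `□ e_i - D_i w` multiplied by `f`. It allows the second-order equations to be traded for
the `□ e_i`, and conversely gives their expanded form in the forward scheme. -/
theorem potential_eq (i : Fin 4) (f : AddMonoidAlgebra K G) :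
    ∑ j, (comp i (f * (D j * D j)) - comp j (f * (D i * D j))) =
      boxMap D i f - divMap D (f * D i) := by
  rw [Finset.sum_sub_distrib, boxMap_apply, divMap_apply]
  simp only [mul_assoc]

/-- The twisted operators act from the left on the factor `f` alone, as the `D_j` pass through `θ`
unchanged. Hence the span of all `f w` and `f □ e_i` is stable. Conversely, the `f` with `f w` in a
stable subspace form a `θ`-stable subspace containing `1`, which is everything by `hgen`; the same
then holds for `□ e_i`. -/
theorem stableSpan_potentialEquations {C : Type} (T : C → (Fin 4 × G →₀ K) →+ (Fin 4 × G →₀ K))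
    (θ : C → AddMonoidAlgebra K G → AddMonoidAlgebra K G)
    (d : Fin 4 → (Fin 4 × G →₀ K) →+ (Fin 4 × G →₀ K))
    (hT : ∀ c i f, T c (comp i f) = comp i (θ c f))
    (hθ : ∀ c j f, θ c (f * D j) = θ c f * D j)
    (hgen : ∀ V : Submodule K (AddMonoidAlgebra K G), 1 ∈ V → (∀ c, ∀ f ∈ V, θ c f ∈ V) → V = ⊤)
    (hd : ∀ i j, d j (comp i 1) = comp i (D j))
    (hdd : ∀ i j l, d l (comp i (D j)) = comp i (D l * D j)) :
    stableSpan T (potentialEquations d fun i => comp i 1) = solModule D := by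
  have hTdiv : ∀ c f, T c (divMap D f) = divMap D (θ c f) := by
    intro c f
    simp only [divMap_apply, map_sum, hT, hθ]
  have hTbox : ∀ c i f, T c (boxMap D i f) = boxMap D i (θ c f) := by
    intro c i f
    simp only [boxMap_apply, map_sum, hT, ← mul_assoc, hθ]
  have h1 : ∑ j, d j (comp j 1) = divMap D 1 := by
    simp only [hd, divMap_apply, one_mul]
  have h2 : ∀ i, ∑ j, (d j (d j (comp i 1)) - d i (d j (comp j 1))) =
      boxMap D i 1 - divMap D (D i) := by
    intro i
    have h3 := potential_eq (D := D) i 1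
    simp only [one_mul] at h3
    simp only [hd, hdd, h3]
  apply le_antisymm
  · refine sInf_le ⟨?_, ?_⟩
    · rintro _ (h3 | ⟨i, rfl⟩)
      · rw [Set.mem_singleton_iff] at h3
        rw [h3, h1]
        exact divMap_mem _
      · simp only [h2]
        exact Submodule.sub_mem _ (boxMap_mem _ _) (divMap_mem _)
    · intro c x hx
      obtain ⟨_, ⟨f, rfl⟩, z, hz, rfl⟩ := Submodule.mem_sup.1 hx
      rw [map_add]
      refine Submodule.add_mem _ (hTdiv c f ▸ divMap_mem _) ?_
      refine Submodule.iSup_induction _ (motive := fun z => T c z ∈ solModule D) hz ?_ ?_ ?_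
      · rintro i _ ⟨f, rfl⟩
        exact hTbox c i f ▸ boxMap_mem _ _
      · rw [map_zero]
        exact Submodule.zero_mem _
      · intro a b ha hb
        rw [map_add]
        exact Submodule.add_mem _ ha hb
  · refine le_sInf ?_
    rintro N ⟨hS, hN⟩
    have hdiv : ∀ f, divMap D f ∈ N := by
      have h3 : N.comap (divMap D) = ⊤ := by
        refine hgen _ ?_ ?_
        · rw [Submodule.mem_comap, ← h1]
          exact hS (Or.inl rfl)
        · intro c f hf
          rw [Submodule.mem_comap, ← hTdiv]
          exact hN c _ hf
      exact fun f => Submodule.eq_top_iff'.1 h3 f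
    refine solModule_le hdiv fun i => ?_
    have h3 : N.comap (boxMap D i) = ⊤ := by
      refine hgen _ ?_ ?_
      · have h4 : boxMap D i 1 - divMap D (D i) ∈ N := h2 i ▸ hS (Or.inr ⟨i, rfl⟩)
        exact (Submodule.sub_mem_iff_left _ (hdiv _)).1 h4
      · intro c f hf
        rw [Submodule.mem_comap, ← hTbox]
        exact hN c _ hf
    exact fun f => Submodule.eq_top_iff'.1 h3 f

end Constant

/-! ### Elimination of redundant relations and the resulting count -/

section System

variable {K Λ : Type*} [Field K] {G J : Type} [AddCommMonoid G] [LinearOrder Λ] [WellFoundedLT Λ]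
  {D : Fin 4 → AddMonoidAlgebra K G} {μ : Fin 4 × G → Λ} {lm₀ : G → G}

theorem solModule_le_of_isReductionSystem
    (h : IsReductionSystem μ (fun p : Fin 4 × G => boxMap D p.1 (mon K p.2))
      fun p => (p.1, lm₀ p.2))
    {W : Submodule K (Fin 4 × G →₀ K)} (hbox : ∀ i k, boxMap D i (mon K k) ∈ W)
    (hdiv : ∀ k, k ∉ Set.range lm₀ → divMap D (mon K k) ∈ W) : solModule D ≤ W := by
  have hbox' : ∀ i f, boxMap D i f ∈ W := by
    intro i
    have h1 : (⊤ : Submodule K (AddMonoidAlgebra K G)) ≤ W.comap (boxMap D i) := by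
      rw [← span_mon, Submodule.span_le]
      rintro _ ⟨k, rfl⟩
      exact hbox i k
    exact fun f => h1 trivial
  refine solModule_le ?_ hbox'
  suffices (⊤ : Submodule K (AddMonoidAlgebra K G)) ≤ W.comap (divMap D) from fun f => this trivial
  rw [← span_mon, Submodule.span_le]
  rintro _ ⟨k, rfl⟩
  -- Forgetting the index of the summand turns the reduction in the free module into division by `□`
  -- in the monoid algebra itself.
  let s : (Fin 4 × G →₀ K) →ₗ[K] AddMonoidAlgebra K G :=
    Finsupp.linearCombination K fun t : Fin 4 × G => mon K t.2
  have hs : ∀ i f, s (comp i f) = f := by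
    intro i f
    induction f using AddMonoidAlgebra.induction_linear with
    | zero => simp
    | add f g hf hg => rw [map_add, map_add, hf, hg]
    | single k a => simp [s]
  have h1 := h.single_mem ((0 : Fin 4), k)
  have h2 : Submodule.span K (Set.range fun p : Fin 4 × G => boxMap D p.1 (mon K p.2)) ⊔
      Submodule.span K {x | ∃ t', t' ∉ Set.range (fun p : Fin 4 × G => (p.1, lm₀ p.2)) ∧
        μ t' ≤ μ ((0 : Fin 4), k) ∧ x = Finsupp.single t' 1} ≤ W.comap (divMap D ∘ₗ s) := by
    rw [sup_le_iff, Submodule.span_le, Submodule.span_le]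
    constructor
    · rintro _ ⟨⟨i, l⟩, rfl⟩
      rw [SetLike.mem_coe, Submodule.mem_comap, LinearMap.comp_apply]
      simp only [boxMap, LinearMap.comp_apply, LinearMap.mulRight_apply]
      -- Multiples of `□ w` are already combinations of multiples of the `□ e_i`.
      rw [hs, divMap_mul_box]
      exact Submodule.sum_mem _ fun i _ => hbox' i _
    · rintro _ ⟨⟨i, l⟩, hl, _, rfl⟩
      rw [SetLike.mem_coe, Submodule.mem_comap, LinearMap.comp_apply, ← comp_single, hs]
      refine hdiv l ?_
      rintro ⟨k, rfl⟩
      exact hl ⟨(i, k), rfl⟩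
  have h3 := h2 h1
  rwa [Submodule.mem_comap, LinearMap.comp_apply, ← comp_single, hs] at h3

theorem filtrationDim_solModule {ord : Fin 4 × G → ℕ}
    (hord : ∀ t t', μ t ≤ μ t' → ord t ≤ ord t') (hfin : ∀ r, {t | ord t ≤ r}.Finite)
    (h : IsReductionSystem μ (fun p : Fin 4 × G => boxMap D p.1 (mon K p.2))
      fun p => (p.1, lm₀ p.2))
    {rel : J → (Fin 4 × G →₀ K)} {lm : J → Fin 4 × G} (h' : IsReductionSystem μ rel lm)
    (hmem : ∀ j, rel j ∈ solModule D) (hlm : ∀ j, (lm j).2 ∉ Set.range lm₀)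
    (hdiv : ∀ (W : Submodule K (Fin 4 × G →₀ K)), (∀ i f, boxMap D i f ∈ W) → (∀ j, rel j ∈ W) →
      ∀ k, k ∉ Set.range lm₀ → divMap D (mon K k) ∈ W) (r : ℕ) :
    ∃ n : ℕ, filtrationDim ord (solModule D) r = n ∧
      n + {p : Fin 4 × G | ord (p.1, lm₀ p.2) ≤ r}.ncard + {j | ord (lm j) ≤ r}.ncard =
        {t | ord t ≤ r}.ncard := by
  have h1 := h.sumElim h' (by
    rintro ⟨i, k⟩ j h2
    exact hlm j ⟨k, congrArg Prod.snd h2⟩)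
  have h2 : solModule D = Submodule.span K (Set.range (Sum.elim
      (fun p : Fin 4 × G => boxMap D p.1 (mon K p.2)) rel)) := by
    set W := Submodule.span K (Set.range (Sum.elim
      (fun p : Fin 4 × G => boxMap D p.1 (mon K p.2)) rel)) with hW
    have h3 : ∀ i k, boxMap D i (mon K k) ∈ W := fun i k =>
      Submodule.subset_span ⟨Sum.inl (i, k), rfl⟩
    have h4 : ∀ i f, boxMap D i f ∈ W := by
      intro i
      have h1 : (⊤ : Submodule K (AddMonoidAlgebra K G)) ≤ W.comap (boxMap D i) := by
        rw [← span_mon, Submodule.span_le]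
        rintro _ ⟨k, rfl⟩
        exact h3 i k
      exact fun f => h1 trivial
    apply le_antisymm
    · exact solModule_le_of_isReductionSystem h h3
        (hdiv W h4 fun j => Submodule.subset_span ⟨Sum.inr j, rfl⟩)
    · rw [hW, Submodule.span_le]
      rintro _ ⟨i | j, rfl⟩
      exacts [boxMap_mem _ _, hmem j]
  obtain ⟨n, h5, h6⟩ := h1.filtrationDim_eq hord hfin r
  refine ⟨n, h2 ▸ h5, ?_⟩
  rw [← h6, add_assoc]
  congr 1
  have h7 : {i : (Fin 4 × G) ⊕ J | ord (Sum.elim (fun p => (p.1, lm₀ p.2)) lm i) ≤ r} =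
      Sum.inl '' {p : Fin 4 × G | ord (p.1, lm₀ p.2) ≤ r} ∪ Sum.inr '' {j | ord (lm j) ≤ r} := by
    ext (p | j) <;> simp
  have h8 : {p : Fin 4 × G | ord (p.1, lm₀ p.2) ≤ r}.Finite :=
    (hfin r).preimage (f := fun p : Fin 4 × G => (p.1, lm₀ p.2)) h.inj.injOn
  have h9 : {j | ord (lm j) ≤ r}.Finite := (hfin r).preimage h'.inj.injOn
  rw [h7, Set.ncard_union_eq _ (h8.image _) (h9.image _),
    Set.ncard_image_of_injective _ Sum.inl_injective,
    Set.ncard_image_of_injective _ Sum.inr_injective]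
  rw [Set.disjoint_left]
  rintro _ ⟨p, _, rfl⟩ ⟨j, _, h10⟩
  cases h10

end System

/-! ### Stable ideals generated by linear forms -/

section StableIdeal

variable {K : Type*} [Field K] {τ C : Type}

theorem subset_stableSpan (T : C → (τ →₀ K) →+ (τ →₀ K)) (S : Set (τ →₀ K)) :
    S ⊆ stableSpan T S := by
  intro x hx
  rw [SetLike.mem_coe, stableSpan, Submodule.mem_sInf]
  exact fun N hN => hN.1 hx

theorem stableSpan_stable {T : C → (τ →₀ K) →+ (τ →₀ K)} {S : Set (τ →₀ K)} (c : C) {x : τ →₀ K}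
    (hx : x ∈ stableSpan T S) : T c x ∈ stableSpan T S := by
  rw [stableSpan, Submodule.mem_sInf] at *
  exact fun N hN => hN.2 c x (hx N hN)

/-- The hypothesis `hmul` covers both the product rule and multiplicative operators. It makes the
ideal generated by a stable set of linear forms stable again. -/
theorem stableIdeal_linForm (T : C → (τ →₀ K) →+ (τ →₀ K))
    (T' : C → MvPolynomial τ K →+ MvPolynomial τ K) (S : Set (τ →₀ K))
    (hlin : ∀ c x, T' c (linForm K τ x) = linForm K τ (T c x))
    (hmul : ∀ c f g, T' c (f * g) ∈ Ideal.span {g, T' c g}) :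
    stableIdeal T' (linForm K τ '' S) = Ideal.span (linForm K τ '' stableSpan T S) := by
  apply le_antisymm
  · refine sInf_le ⟨(Set.image_mono (subset_stableSpan T S)).trans Ideal.subset_span, ?_⟩
    intro c x hx
    induction hx using Submodule.span_induction with
    | mem x hx =>
      obtain ⟨z, hz, rfl⟩ := hx
      rw [hlin]
      exact Ideal.subset_span ⟨_, stableSpan_stable c hz, rfl⟩
    | zero =>
      rw [map_zero]
      exact Ideal.zero_mem _
    | add x z _ _ hx hz =>
      rw [map_add]
      exact Ideal.add_mem _ hx hz
    | smul a x hx hx' =>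
      refine (Ideal.span_le.2 ?_) (hmul c a x)
      rintro _ (rfl | rfl)
      exacts [hx, hx']
  · refine le_sInf ?_
    rintro I ⟨hS, hI⟩
    rw [Ideal.span_le]
    rintro _ ⟨x, hx, rfl⟩
    have h1 : stableSpan T S ≤ (I.restrictScalars K).comap (linForm K τ) := by
      refine sInf_le ⟨fun z hz => hS ⟨z, hz, rfl⟩, fun c z hz => ?_⟩
      have h2 := hI c _ hz
      rwa [hlin] at h2
    exact h1 hx

theorem image_potentialEquations {A B F : Type*} [AddCommGroup A] [AddCommGroup B]
    [FunLike F A B] [AddMonoidHomClass F A B] (L : F)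
    (d : Fin 4 → A →+ A) (d' : Fin 4 → B →+ B) (hd : ∀ j x, L (d j x) = d' j (L x))
    (ψ : Fin 4 → A) :
    L '' potentialEquations d ψ = potentialEquations d' fun i => L (ψ i) := by
  rw [potentialEquations, potentialEquations, Set.image_union, Set.image_singleton,
    ← Set.range_comp]
  congr 2
  · rw [map_sum]
    simp only [hd]
  · ext i
    simp only [Function.comp_apply, map_sum, map_sub, hd]

end StableIdeal

/-! ### Reduction of the three systems to constant coefficients -/

section FreeOperators

variable {K : Type*} [Field K]

theorem e_eq (i : Fin 4) : e K i = comp i 1 :=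
  (comp_single i 0 1).symm

theorem eInv_eq (i : Fin 4) : eInv K i = comp i 1 :=
  (comp_single i 0 1).symm

theorem map_mul_mon_derivation {G : Type} [AddCommMonoid G] (δ : Derivation ℤ K K)
    (f : AddMonoidAlgebra K G) (k : G) :
    AddMonoidAlgebra.map (δ : K →+ K) (f * mon K k) =
      AddMonoidAlgebra.map (δ : K →+ K) f * mon K k := by
  induction f using AddMonoidAlgebra.induction_linear with
  | zero => simp [AddMonoidAlgebra.map_zero]
  | add f g hf hg => rw [add_mul, AddMonoidAlgebra.map_add, AddMonoidAlgebra.map_add, hf, hg,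
      add_mul]
  | single l a => simp [AddMonoidAlgebra.single_mul_single, AddMonoidAlgebra.map_single]

/-- Differentiation followed by the product rule: `δ_j` on `K[Δ]`, written on the left. -/
noncomputable def leftDer (δ : Fin 4 → Derivation ℤ K K) (j : Fin 4)
    (f : AddMonoidAlgebra K (Fin 4 → ℕ)) : AddMonoidAlgebra K (Fin 4 → ℕ) :=
  AddMonoidAlgebra.map (δ j : K →+ K) f + f * mon K (Pi.single j 1)

theorem freeDer_comp (δ : Fin 4 → Derivation ℤ K K) (j i : Fin 4)
    (f : AddMonoidAlgebra K (Fin 4 → ℕ)) :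
    freeDer 4 δ j (comp i f) = comp i (leftDer δ j f) := by
  induction f using AddMonoidAlgebra.induction_linear with
  | zero => simp [leftDer, AddMonoidAlgebra.map_zero]
  | add f g hf hg =>
    have h1 : leftDer δ j (f + g) = leftDer δ j f + leftDer δ j g := by
      simp only [leftDer, AddMonoidAlgebra.map_add, add_mul]
      abel
    rw [map_add, map_add, hf, hg, h1, map_add]
  | single l a => simp [freeDer, leftDer, AddMonoidAlgebra.map_single,
      AddMonoidAlgebra.single_mul_single, Term.shift]

theorem closure_single_nat {m : ℕ} {M : AddSubmonoid (Fin m → ℕ)}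
    (h : ∀ j, Pi.single j 1 ∈ M) (k : Fin m → ℕ) : k ∈ M := by
  rw [← Finset.univ_sum_single k]
  refine M.sum_mem fun j _ => ?_
  have h1 := M.nsmul_mem (h j) (k j)
  rwa [← Pi.single_smul, smul_eq_mul, mul_one] at h1

theorem closure_single_int {m : ℕ} {M : AddSubmonoid (Fin m → ℤ)}
    (h : ∀ j, Pi.single j 1 ∈ M) (h' : ∀ j, Pi.single j (-1) ∈ M) (k : Fin m → ℤ) : k ∈ M := by
  rw [← Finset.univ_sum_single k]
  refine M.sum_mem fun j _ => ?_
  obtain ⟨n, hn | hn⟩ := Int.eq_nat_or_neg (k j)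
  · have h1 := M.nsmul_mem (h j) n
    rw [← Pi.single_smul] at h1
    rw [hn]
    simpa using h1
  · have h1 := M.nsmul_mem (h' j) n
    rw [← Pi.single_smul] at h1
    rw [hn]
    simpa using h1

theorem eq_top_of_mon_mem {G : Type} {V : Submodule K (AddMonoidAlgebra K G)}
    (h : ∀ k, mon K k ∈ V) : V = ⊤ := by
  rw [eq_top_iff, ← span_mon, Submodule.span_le]
  rintro _ ⟨k, rfl⟩
  exact h k

/-- The exponents by which the monomials in `V` may be shifted. -/
def shiftSubmonoid {G : Type} [AddCommMonoid G] (V : Submodule K (AddMonoidAlgebra K G)) :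
    AddSubmonoid G where
  carrier := {a | ∀ k, mon K k ∈ V → mon K (k + a) ∈ V}
  zero_mem' k hk := by rwa [add_zero]
  add_mem' ha hb k hk := by
    rw [← add_assoc]
    exact hb _ (ha _ hk)

theorem mon_mem_of_mem_shiftSubmonoid {G : Type} [AddCommMonoid G]
    {V : Submodule K (AddMonoidAlgebra K G)} (h1 : 1 ∈ V) {k : G} (hk : k ∈ shiftSubmonoid V) :
    mon K k ∈ V := by
  have h2 := hk 0 h1
  rwa [zero_add] at h2

/-- The symbols of the partial derivatives. -/
noncomputable def derSym (K : Type*) [Field K] (j : Fin 4) : AddMonoidAlgebra K (Fin 4 → ℕ) :=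
  mon K (Pi.single j 1)

theorem differentialSubmodule_eq (δ : Fin 4 → Derivation ℤ K K) :
    differentialSubmodule δ = solModule (derSym K) := by
  have h1 : e K = fun i => comp i 1 := funext e_eq
  rw [differentialSubmodule, h1]
  have hmon : ∀ j k, leftDer δ j (mon K k) = mon K (k + Pi.single j 1) := by
    intro j k
    simp [leftDer, AddMonoidAlgebra.map_single, AddMonoidAlgebra.single_mul_single]
  refine stableSpan_potentialEquations _ (leftDer δ) _ (freeDer_comp δ) ?_ ?_ ?_ ?_
  · intro c j f
    rw [leftDer, derSym, map_mul_mon_derivation, leftDer]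
    ring
  · intro V hV hs
    refine eq_top_of_mon_mem fun k => mon_mem_of_mem_shiftSubmonoid hV ?_
    refine closure_single_nat (fun j l hl => ?_) k
    rw [← hmon]
    exact hs j _ hl
  · intro i j
    rw [freeDer_comp, AddMonoidAlgebra.one_def, hmon, zero_add, derSym]
  · intro i j l
    rw [freeDer_comp, derSym, hmon, derSym, AddMonoidAlgebra.single_mul_single, one_mul, add_comm]

/-- The action of `δ_j^z` on `K[Δ*]` written on the left, where `φ` is the automorphism `δ_j^z`
of `K`. -/
noncomputable def leftTrans (φ : K →+* K) (k : Fin 4 → ℤ) (f : AddMonoidAlgebra K (Fin 4 → ℤ)) :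
    AddMonoidAlgebra K (Fin 4 → ℤ) :=
  AddMonoidAlgebra.map (φ : K →+ K) f * mon K k

theorem leftTrans_mul (φ : K →+* K) (k : Fin 4 → ℤ) (f g : AddMonoidAlgebra K (Fin 4 → ℤ))
    (hg : AddMonoidAlgebra.map (φ : K →+ K) g = g) :
    leftTrans φ k (f * g) = leftTrans φ k f * g := by
  rw [leftTrans, leftTrans, AddMonoidAlgebra.map_mul, hg]
  ring

theorem leftTrans_mon (φ : K →+* K) (k l : Fin 4 → ℤ) :
    leftTrans φ k (mon K l) = mon K (l + k) := by
  simp [leftTrans, AddMonoidAlgebra.map_single, AddMonoidAlgebra.single_mul_single]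

theorem leftTrans_comp (φ : K →+* K) (j : Fin 4) (z : ℤ) (i : Fin 4)
    (f : AddMonoidAlgebra K (Fin 4 → ℤ)) :
    Finsupp.mapDomain (InvTerm.shift j z) (Finsupp.mapRange φ (map_zero φ) (comp i f)) =
      comp i (leftTrans φ (Pi.single j z) f) := by
  induction f using AddMonoidAlgebra.induction_linear with
  | zero => simp [leftTrans, AddMonoidAlgebra.map_zero]
  | add f g hf hg =>
    have h1 : leftTrans φ (Pi.single j z) (f + g) =
        leftTrans φ (Pi.single j z) f + leftTrans φ (Pi.single j z) g := by
      simp only [leftTrans, AddMonoidAlgebra.map_add, add_mul]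
    rw [map_add, Finsupp.mapRange_add (map_add φ), Finsupp.mapDomain_add, hf, hg, h1, map_add]
  | single l a => simp [leftTrans, AddMonoidAlgebra.map_single,
      AddMonoidAlgebra.single_mul_single, InvTerm.shift]

/-- The operators `δ_j` and `δ_j⁻¹` on `K[Δ*]`, written on the left. -/
noncomputable def leftOps (σ : Fin 4 → K ≃+* K) :
    Fin 4 ⊕ Fin 4 → AddMonoidAlgebra K (Fin 4 → ℤ) → AddMonoidAlgebra K (Fin 4 → ℤ) :=
  Sum.elim (fun j => leftTrans (σ j : K →+* K) (Pi.single j 1))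
    fun j => leftTrans ((σ j).symm : K →+* K) (Pi.single j (-1))

theorem freeTrans_comp (σ : Fin 4 → K ≃+* K) (j i : Fin 4) (f : AddMonoidAlgebra K (Fin 4 → ℤ)) :
    freeTrans 4 σ j (comp i f) = comp i (leftTrans (σ j : K →+* K) (Pi.single j 1) f) :=
  leftTrans_comp (σ j : K →+* K) j 1 i f

theorem freeTransInv_comp (σ : Fin 4 → K ≃+* K) (j i : Fin 4)
    (f : AddMonoidAlgebra K (Fin 4 → ℤ)) :
    freeTransInv 4 σ j (comp i f) =
      comp i (leftTrans ((σ j).symm : K →+* K) (Pi.single j (-1)) f) :=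
  leftTrans_comp ((σ j).symm : K →+* K) j (-1) i f

/-- The hypothesis `hD` says that the symbols have coefficients fixed by all endomorphisms of `K`.
Accordingly `hd` is needed only for such `f`, namely `1` and the symbols. -/
theorem stableSpan_inversive (σ : Fin 4 → K ≃+* K) (D : Fin 4 → AddMonoidAlgebra K (Fin 4 → ℤ))
    (hD : ∀ (φ : K →+* K) j, AddMonoidAlgebra.map (φ : K →+ K) (D j) = D j)
    (d : Fin 4 → (Fin 4 × (Fin 4 → ℤ) →₀ K) →+ (Fin 4 × (Fin 4 → ℤ) →₀ K))
    (hd : ∀ i j f, (∀ φ : K →+* K, AddMonoidAlgebra.map (φ : K →+ K) f = f) →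
      d j (comp i f) = comp i (D j * f)) :
    stableSpan (Sum.elim (freeTrans 4 σ) (freeTransInv 4 σ)) (potentialEquations d (eInv K)) =
      solModule D := by
  have h1 : eInv K = fun i => comp i 1 := funext eInv_eq
  rw [h1]
  refine stableSpan_potentialEquations _ (leftOps σ) _ ?_ ?_ ?_ ?_ ?_
  · rintro (c | c) i f
    exacts [freeTrans_comp σ c i f, freeTransInv_comp σ c i f]
  · rintro (c | c) j f
    exacts [leftTrans_mul _ _ _ _ (hD _ j), leftTrans_mul _ _ _ _ (hD _ j)]
  · intro V hV hs
    refine eq_top_of_mon_mem fun k => mon_mem_of_mem_shiftSubmonoid hV ?_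
    refine closure_single_int (fun j l hl => ?_) (fun j l hl => ?_) k
    · rw [← leftTrans_mon (σ j : K →+* K)]
      exact hs (Sum.inl j) _ hl
    · rw [← leftTrans_mon ((σ j).symm : K →+* K)]
      exact hs (Sum.inr j) _ hl
  · intro i j
    rw [hd i j 1 fun φ => AddMonoidAlgebra.map_one φ, mul_one]
  · intro i j l
    rw [hd i l _ fun φ => hD φ j]

/-- The symbols of the forward differences. -/
noncomputable def forwardSym (K : Type*) [Field K] (j : Fin 4) : AddMonoidAlgebra K (Fin 4 → ℤ) :=
  mon K (Pi.single j 1) - 1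

theorem forwardSubmodule_eq (σ : Fin 4 → K ≃+* K) :
    forwardSubmodule σ = solModule (forwardSym K) := by
  refine stableSpan_inversive σ _ ?_ _ ?_
  · intro φ j
    rw [forwardSym, AddMonoidAlgebra.map_sub, AddMonoidAlgebra.map_one,
      AddMonoidAlgebra.map_single]
    simp
  · intro i j f hf
    rw [forwardDifference, AddMonoidHom.sub_apply, freeTrans_comp, AddMonoidHom.id_apply, leftTrans,
      hf, ← map_sub, forwardSym, sub_mul, one_mul, mul_comm]

/-- The symbols of the symmetric differences. -/
noncomputable def symmetricSym (K : Type*) [Field K] (j : Fin 4) :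
    AddMonoidAlgebra K (Fin 4 → ℤ) :=
  (2⁻¹ : K) • (mon K (Pi.single j 1) - mon K (Pi.single j (-1)))

theorem symmetricSubmodule_eq (σ : Fin 4 → K ≃+* K) :
    symmetricSubmodule σ = solModule (symmetricSym K) := by
  refine stableSpan_inversive σ _ ?_ _ ?_
  · intro φ j
    rw [symmetricSym, smul_sub, AddMonoidAlgebra.map_sub, AddMonoidAlgebra.smul_single,
      AddMonoidAlgebra.smul_single, AddMonoidAlgebra.map_single, AddMonoidAlgebra.map_single]
    simp [map_ofNat]
  · intro i j f hf
    rw [symmetricDifference, AddMonoidHom.smul_apply, AddMonoidHom.sub_apply, freeTrans_comp,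
      freeTransInv_comp, leftTrans, leftTrans, hf, hf, ← map_sub, symmetricSym, ← map_smul,
      smul_mul_assoc, sub_mul, mul_comm f, mul_comm f]

end FreeOperators

/-! ### The ideals of differential and difference polynomials -/

section PolynomialOperators

variable {K : Type*} [Field K]

theorem coeffDer_mul {τ : Type} (D : Derivation ℤ K K) (f g : MvPolynomial τ K) :
    coeffDer D (f * g) = f * coeffDer D g + g * coeffDer D f := by
  have hmon : ∀ (u : τ →₀ ℕ) (a : K),
      coeffDer D (MvPolynomial.monomial u a) = MvPolynomial.monomial u (D a) := fun u a =>
    AddMonoidAlgebra.map_single ..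
  induction f using MvPolynomial.induction_on' with
  | monomial u a =>
    induction g using MvPolynomial.induction_on' with
    | monomial v b =>
      rw [MvPolynomial.monomial_mul, hmon, hmon, hmon, MvPolynomial.monomial_mul,
        MvPolynomial.monomial_mul, add_comm v u, ← map_add, D.leibniz, smul_eq_mul, smul_eq_mul]
    | add g h hg hh => rw [mul_add, map_add, map_add, hg, hh]; ring
  | add f h hf hh => rw [add_mul, map_add, map_add, hf, hh]; ring

theorem polyDer_mul_mem (δ : Fin 4 → Derivation ℤ K K) (j : Fin 4)
    (f g : MvPolynomial (Term 4 4) K) :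
    polyDer 4 δ j (f * g) ∈ Ideal.span {g, polyDer 4 δ j g} := by
  have h1 : polyDer 4 δ j (f * g) = f * polyDer 4 δ j g + polyDer 4 δ j f * g := by
    simp only [polyDer, AddMonoidHom.add_apply, coeffDer_mul, LinearMap.toAddMonoidHom_coe,
      Derivation.coeFn_coe, Derivation.leibniz, smul_eq_mul]
    ring
  rw [h1]
  exact Ideal.add_mem _ (Ideal.mul_mem_left _ _ (Ideal.subset_span (by simp)))
    (Ideal.mul_mem_left _ _ (Ideal.subset_span (by simp)))

theorem polyDer_linForm (δ : Fin 4 → Derivation ℤ K K) (j : Fin 4) (x : Term 4 4 →₀ K) :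
    polyDer 4 δ j (linForm K _ x) = linForm K _ (freeDer 4 δ j x) := by
  induction x using Finsupp.induction_linear with
  | zero => simp
  | add x z hx hz => simp only [map_add, hx, hz]
  | single t a =>
    have h1 : coeffDer (δ j) (a • MvPolynomial.X t) = (δ j a) • MvPolynomial.X t := by
      rw [MvPolynomial.X, MvPolynomial.smul_monomial, MvPolynomial.smul_monomial, smul_eq_mul,
        smul_eq_mul, mul_one, mul_one]
      exact AddMonoidAlgebra.map_single ..
    simp [freeDer, polyDer, linForm_single, h1]

theorem differentialIdeal_eq (δ : Fin 4 → Derivation ℤ K K) :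
    differentialIdeal δ = Ideal.span (linForm K _ '' differentialSubmodule δ) := by
  rw [differentialSubmodule, ← stableIdeal_linForm _ _ _ (polyDer_linForm δ) (polyDer_mul_mem δ),
    image_potentialEquations _ _ (polyDer 4 δ) fun j x => (polyDer_linForm δ j x).symm,
    differentialIdeal]
  congr 2
  ext1 i
  rw [e, linForm_single, one_smul, y]

theorem polyTrans_linForm (σ : Fin 4 → K ≃+* K) (j : Fin 4) (x : InvTerm 4 4 →₀ K) :
    polyTrans 4 σ j (linForm K _ x) = linForm K _ (freeTrans 4 σ j x) := by
  induction x using Finsupp.induction_linear with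
  | zero => simp
  | add x z hx hz => simp only [map_add, hx, hz]
  | single t a => simp [freeTrans, polyTrans, linForm_single, MvPolynomial.smul_eq_C_mul]

theorem polyTransInv_linForm (σ : Fin 4 → K ≃+* K) (j : Fin 4) (x : InvTerm 4 4 →₀ K) :
    polyTransInv 4 σ j (linForm K _ x) = linForm K _ (freeTransInv 4 σ j x) := by
  induction x using Finsupp.induction_linear with
  | zero => simp
  | add x z hx hz => simp only [map_add, hx, hz]
  | single t a => simp [freeTransInv, polyTransInv, linForm_single, MvPolynomial.smul_eq_C_mul]

theorem stableIdeal_inversive (σ : Fin 4 → K ≃+* K) (S : Set (InvTerm 4 4 →₀ K)) :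
    stableIdeal (Sum.elim (polyTrans 4 σ) (polyTransInv 4 σ)) (linForm K _ '' S) =
      Ideal.span (linForm K _ '' stableSpan (Sum.elim (freeTrans 4 σ) (freeTransInv 4 σ)) S) := by
  apply stableIdeal_linForm
  · rintro (j | j) x
    exacts [polyTrans_linForm σ j x, polyTransInv_linForm σ j x]
  · rintro (j | j) f g
    · have h1 : polyTrans 4 σ j (f * g) = polyTrans 4 σ j f * polyTrans 4 σ j g := map_mul
        ((MvPolynomial.rename (InvTerm.shift j 1)).toRingHom.comp
          (MvPolynomial.map ((σ j : K ≃+* K) : K →+* K))) f g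
      rw [Sum.elim_inl, h1]
      exact Ideal.mul_mem_left _ _ (Ideal.subset_span (by simp))
    · have h1 : polyTransInv 4 σ j (f * g) = polyTransInv 4 σ j f * polyTransInv 4 σ j g := map_mul
        ((MvPolynomial.rename (InvTerm.shift j (-1))).toRingHom.comp
          (MvPolynomial.map ((σ j).symm : K →+* K))) f g
      rw [Sum.elim_inr, h1]
      exact Ideal.mul_mem_left _ _ (Ideal.subset_span (by simp))

theorem linForm_eInv (i : Fin 4) : linForm K _ (eInv K i) = yInv K i := by
  rw [eInv, linForm_single, one_smul, yInv]

theorem forwardIdeal_eq (σ : Fin 4 → K ≃+* K) :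
    forwardIdeal σ = Ideal.span (linForm K _ '' forwardSubmodule σ) := by
  rw [forwardSubmodule, ← stableIdeal_inversive,
    image_potentialEquations _ _ (forwardDifference (polyTrans 4 σ)), forwardIdeal]
  · simp only [linForm_eInv]
  · intro j x
    simp [forwardDifference, polyTrans_linForm]

theorem symmetricIdeal_eq (σ : Fin 4 → K ≃+* K) :
    symmetricIdeal σ = Ideal.span (linForm K _ '' symmetricSubmodule σ) := by
  rw [symmetricSubmodule, ← stableIdeal_inversive, image_potentialEquations _ _
    (symmetricDifference K (polyTrans 4 σ) (polyTransInv 4 σ)), symmetricIdeal]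
  · simp only [linForm_eInv]
  · intro j x
    simp [symmetricDifference, polyTrans_linForm, polyTransInv_linForm]

/-- For an ideal generated by linear forms the two dimension polynomials agree. -/
theorem isDimensionPolynomialOfSystem_span_linForm {τ : Type} {ord : τ → ℕ}
    {N : Submodule K (τ →₀ K)} {φ : Polynomial ℚ}
    (h : IsDimensionPolynomial (filtrationDim ord N) φ) :
    IsDimensionPolynomialOfSystem ord N (Ideal.span (linForm K τ '' N)) φ where
  dim := h
  prime := isPrime_span_linForm N
  trdeg := by
    have h1 : filtrationTrdeg ord (Ideal.span (linForm K τ '' N)) = filtrationDim ord N :=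
      funext (filtrationTrdeg_span_linForm ord N)
    rwa [h1]

end PolynomialOperators

/-! ### Leading terms for the differential system -/

section DifferentialReduction

variable {K : Type*} [Field K]

theorem Term.ord_add_single (k : Fin 4 → ℕ) (i j : Fin 4) (n : ℕ) :
    Term.ord (i, k + Pi.single j n) = ∑ l, k l + n := by
  simp [Term.ord, Finset.sum_add_distrib]

/-- Terms are compared by order, then by whether they lie in the second summand, then by the
exponent of `δ_1`. -/
def derWeight (t : Fin 4 × (Fin 4 → ℕ)) : ℕ ×ₗ ℕ ×ₗ ℕ :=
  toLex (Term.ord t, toLex (if t.1 = 1 then 1 else 0, t.2 0))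

theorem derWeight_lt {t t' : Fin 4 × (Fin 4 → ℕ)} :
    derWeight t < derWeight t' ↔ Term.ord t < Term.ord t' ∨ Term.ord t = Term.ord t' ∧
      ((if t.1 = 1 then 1 else 0) < (if t'.1 = 1 then 1 else 0) ∨
        (if t.1 = 1 then 1 else 0) = (if t'.1 = 1 then 1 else 0) ∧ t.2 0 < t'.2 0) := by
  simp only [derWeight, Prod.Lex.toLex_lt_toLex]

/-- All four terms of `δ^k □ e_i` have the same order and summand; the one with `δ_1²` has the
greatest exponent of `δ_1`. -/
theorem isReductionSystem_derBox :
    IsReductionSystem derWeight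
      (fun p : Fin 4 × (Fin 4 → ℕ) => boxMap (derSym K) p.1 (mon K p.2))
      fun p => (p.1, p.2 + Pi.single 0 2) := by
  refine .of_sub_mem ?_ fun ⟨i, k⟩ => ⟨1, one_ne_zero, ?_⟩
  · rintro ⟨i, k⟩ ⟨i', k'⟩ h
    simpa using h
  · have h1 : ∀ l, comp i (mon K k * (derSym K l * derSym K l)) =
        Finsupp.single (i, k + Pi.single l 2) 1 := by
      intro l
      simp [derSym, AddMonoidAlgebra.single_mul_single, ← Pi.single_add]
    rw [boxMap_apply]
    refine sum_sub_mem_of_mem 0 ?_ fun l hl => ?_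
    · rw [h1, sub_self]
      exact Submodule.zero_mem _
    · rw [h1]
      refine Finsupp.single_mem_supported _ _ (derWeight_lt.2 (Or.inr ⟨?_, Or.inr ⟨rfl, ?_⟩⟩))
      · rw [Term.ord_add_single, Term.ord_add_single]
      · simp [Pi.single_eq_of_ne hl.symm]

/-- The weight favours the second summand, so `δ_2 δ^k e_2` leads in `δ^k w`. Since `δ_2` leaves the
exponent of `δ_1` at most `1`, no leading term of a multiple of `□` is hit. -/
theorem isReductionSystem_derDiv :
    IsReductionSystem derWeight
      (fun k : {k : Fin 4 → ℕ // k 0 ≤ 1} => divMap (derSym K) (mon K k.1))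
      fun k => (1, k.1 + Pi.single 1 1) := by
  refine .of_sub_mem ?_ fun ⟨k, hk⟩ => ⟨1, one_ne_zero, ?_⟩
  · rintro ⟨k, hk⟩ ⟨k', hk'⟩ h
    simpa using h
  · have h1 : ∀ l, comp l (mon K k * derSym K l) = Finsupp.single (l, k + Pi.single l 1) 1 := by
      intro l
      simp [derSym, AddMonoidAlgebra.single_mul_single]
    rw [divMap_apply]
    refine sum_sub_mem_of_mem 1 ?_ fun l hl => ?_
    · rw [h1, sub_self]
      exact Submodule.zero_mem _
    · rw [h1]
      refine Finsupp.single_mem_supported _ _ (derWeight_lt.2 (Or.inr ⟨?_, Or.inl ?_⟩))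
      · rw [Term.ord_add_single, Term.ord_add_single]
      · simp [hl]

theorem notMem_range_add_single_nat (k : Fin 4 → ℕ) :
    k ∉ Set.range (fun k : Fin 4 → ℕ => k + Pi.single 0 2) ↔ k 0 ≤ 1 := by
  constructor
  · intro h
    by_contra! h1
    refine h ⟨Function.update k 0 (k 0 - 2), ?_⟩
    funext l
    by_cases hl : l = 0
    · subst hl
      simp
      omega
    · simp [hl]
  · rintro h ⟨l, rfl⟩
    simp at h

theorem filtrationDim_derSym (hfin : ∀ r, {t : Fin 4 × (Fin 4 → ℕ) | Term.ord t ≤ r}.Finite)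
    (r : ℕ) :
    ∃ n : ℕ, filtrationDim Term.ord (solModule (derSym K)) r = n ∧
      n + {p : Fin 4 × (Fin 4 → ℕ) | Term.ord (p.1, p.2 + Pi.single 0 2) ≤ r}.ncard +
        {k : {k : Fin 4 → ℕ // k 0 ≤ 1} |
          Term.ord ((1 : Fin 4), k.1 + Pi.single 1 1) ≤ r}.ncard =
        {t : Fin 4 × (Fin 4 → ℕ) | Term.ord t ≤ r}.ncard := by
  have h1 := filtrationDim_solModule (μ := derWeight) (lm₀ := fun k => k + Pi.single 0 2)
    (ord := fun t => Term.ord t) (K := K) (D := derSym K) (fun t t' h => ?_) hfin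
    isReductionSystem_derBox isReductionSystem_derDiv
    (fun j => divMap_mem _) (fun j => ?_) (fun W _ h k hk => ?_) r
  · exact h1
  · by_contra! h1
    exact absurd h (not_le.2 (derWeight_lt.2 (Or.inl h1)))
  · rw [notMem_range_add_single_nat]
    simpa using j.2
  · exact h ⟨k, (notMem_range_add_single_nat k).1 hk⟩

end DifferentialReduction

/-! ### Leading terms for the symmetric scheme -/

section SymmetricReduction

variable {K : Type*} [Field K]

/-- The order of the monomial with exponent `k`. -/
def size (k : Fin 4 → ℤ) : ℕ := ∑ j, (k j).natAbs

theorem size_add_single (k : Fin 4 → ℤ) (j : Fin 4) (z : ℤ) :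
    size (k + Pi.single j z) + (k j).natAbs = size k + (k j + z).natAbs := by
  rw [size, size, ← Finset.add_sum_erase _ _ (Finset.mem_univ j),
    ← Finset.add_sum_erase (a := j) _ (fun j => (k j).natAbs) (Finset.mem_univ j)]
  have h1 : ∑ l ∈ Finset.univ.erase j, ((k + Pi.single j z : Fin 4 → ℤ) l).natAbs =
      ∑ l ∈ Finset.univ.erase j, (k l).natAbs := by
    refine Finset.sum_congr rfl fun l hl => ?_
    simp [Finset.ne_of_mem_erase hl]
  rw [h1]
  simp only [Pi.add_apply, Pi.single_eq_same]
  omega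

/-- Terms are compared by order, then by whether they lie in the second summand, then by the
exponents of `δ_1` and `δ_2`, where `z ≥ 0` comes after `-z` and before `-z - 1`. -/
def symWeight (t : Fin 4 × (Fin 4 → ℤ)) : ℕ ×ₗ ℕ ×ₗ ℕ ×ₗ ℕ :=
  toLex (size t.2, toLex (if t.1 = 1 then 1 else 0,
    toLex ((2 * t.2 0 + 1).natAbs, (2 * t.2 1 + 1).natAbs)))

theorem symWeight_lt {t t' : Fin 4 × (Fin 4 → ℤ)} :
    symWeight t < symWeight t' ↔ size t.2 < size t'.2 ∨ size t.2 = size t'.2 ∧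
      ((if t.1 = 1 then 1 else 0) < (if t'.1 = 1 then 1 else 0) ∨
        (if t.1 = 1 then 1 else 0) = (if t'.1 = 1 then 1 else 0) ∧
        ((2 * t.2 0 + 1).natAbs < (2 * t'.2 0 + 1).natAbs ∨
          (2 * t.2 0 + 1).natAbs = (2 * t'.2 0 + 1).natAbs ∧
          (2 * t.2 1 + 1).natAbs < (2 * t'.2 1 + 1).natAbs)) := by
  simp only [symWeight, Prod.Lex.toLex_lt_toLex]

/-- Moves the exponent of `δ_j` away from zero by `z`. -/
def outward (j : Fin 4) (z : ℤ) (k : Fin 4 → ℤ) : Fin 4 → ℤ :=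
  k + Pi.single j (if 0 ≤ k j then z else -z)

theorem outward_apply_of_ne {j l : Fin 4} (h : l ≠ j) (z : ℤ) (k : Fin 4 → ℤ) :
    outward j z k l = k l := by
  simp [outward, h]

theorem outward_apply_self (j : Fin 4) (z : ℤ) (k : Fin 4 → ℤ) :
    outward j z k j = k j + if 0 ≤ k j then z else -z := by
  simp [outward]

theorem size_outward (j : Fin 4) (n : ℕ) (k : Fin 4 → ℤ) :
    size (outward j n k) = size k + n := by
  have h1 := size_add_single k j (if 0 ≤ k j then n else -n)
  rw [outward]
  split_ifs at * <;> omega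

theorem outward_injective (j : Fin 4) (n : ℕ) : Function.Injective (outward j n) := by
  intro k k' h
  funext l
  have h1 := congrFun h l
  by_cases hl : l = j
  · subst hl
    rw [outward_apply_self, outward_apply_self] at h1
    split_ifs at h1 <;> omega
  · rwa [outward_apply_of_ne hl, outward_apply_of_ne hl] at h1

/-- Exponents `≥ 0` move to `≥ 2` and exponents `≤ -1` to `≤ -3`. The gap is asymmetric because `0`
is moved upwards. -/
theorem notMem_range_outward (k : Fin 4 → ℤ) :
    k ∉ Set.range (outward 0 2) ↔ -2 ≤ k 0 ∧ k 0 ≤ 1 := by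
  constructor
  · intro h
    by_contra h1
    refine h ⟨k + Pi.single 0 (if 0 ≤ k 0 then -2 else 2), ?_⟩
    funext l
    by_cases hl : l = 0
    · subst hl
      rw [outward_apply_self]
      simp only [Pi.add_apply, Pi.single_eq_same]
      split_ifs <;> omega
    · rw [outward_apply_of_ne hl]
      simp [hl]
  · rintro h ⟨l, rfl⟩
    rw [outward_apply_self] at h
    split_ifs at h <;> omega

/-- Here `D_l² = (δ_l² - 2 + δ_l⁻²)/4`, and the outward one of `δ_1²`, `δ_1⁻²` leads. At `k 0 = 0`
both have the same order; the values `|2·2 + 1| = 5` and `|2·(-2) + 1| = 3` break the tie in favour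
of `δ_1²`. -/
theorem isReductionSystem_symBox [CharZero K] :
    IsReductionSystem symWeight
      (fun p : Fin 4 × (Fin 4 → ℤ) => boxMap (symmetricSym K) p.1 (mon K p.2))
      fun p => (p.1, outward 0 2 p.2) := by
  refine .of_sub_mem ?_ fun ⟨i, k⟩ => ⟨4⁻¹, by simp, ?_⟩
  · rintro ⟨i, k⟩ ⟨i', k'⟩ h
    rw [Prod.mk.injEq] at h
    exact Prod.ext h.1 (outward_injective 0 2 h.2)
  · have h1 : ∀ l, comp i (mon K k * (symmetricSym K l * symmetricSym K l)) =
        Finsupp.single (i, k + Pi.single l 2) 4⁻¹ + Finsupp.single (i, k + Pi.single l (-2)) 4⁻¹ -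
          Finsupp.single (i, k) 2⁻¹ := by
      intro l
      have h2 : mon K k * (symmetricSym K l * symmetricSym K l) =
          AddMonoidAlgebra.single (k + Pi.single l 2) 4⁻¹ +
          AddMonoidAlgebra.single (k + Pi.single l (-2)) 4⁻¹ -
          (AddMonoidAlgebra.single k 4⁻¹ + AddMonoidAlgebra.single k 4⁻¹) := by
        have h3 : (2⁻¹ * 2⁻¹ : K) = 4⁻¹ := by norm_num
        simp only [symmetricSym, h3, sub_mul, mul_sub,
          AddMonoidAlgebra.single_mul_single, ← Pi.single_add, smul_sub,
          AddMonoidAlgebra.smul_single, smul_eq_mul, mul_one]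
        norm_num
        abel
      have h3 : (4⁻¹ + 4⁻¹ : K) = 2⁻¹ := by norm_num
      rw [h2, ← AddMonoidAlgebra.single_add, h3]
      simp only [map_add, map_sub, comp_single]
    have hsize : size (outward 0 2 k) = size k + 2 := size_outward 0 2 k
    have h0 := outward_apply_self 0 2 k
    have h3 : Finsupp.single (i, k) (2⁻¹ : K) ∈
        Finsupp.supported K K {t | symWeight t < symWeight (i, outward 0 2 k)} :=
      Finsupp.single_mem_supported _ _ (symWeight_lt.2 (Or.inl (by simp only; omega)))
    have h4 : ∀ l z, z = 2 ∨ z = -2 → (l ≠ 0 ∨ outward 0 2 k ≠ k + Pi.single l z) →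
        Finsupp.single (i, k + Pi.single l z) (4⁻¹ : K) ∈
        Finsupp.supported K K {t | symWeight t < symWeight (i, outward 0 2 k)} := by
      intro l z hz hl
      refine Finsupp.single_mem_supported _ _ (symWeight_lt.2 ?_)
      have h5 := size_add_single k l z
      simp only [lt_self_iff_false, false_or, true_and]
      by_cases h : l = 0
      · subst h
        have h6 : z ≠ if 0 ≤ k 0 then 2 else -2 := by
          rintro rfl
          simp [outward] at hl
        simp only [Pi.add_apply, Pi.single_eq_same]
        push_cast at *
        split_ifs at * <;> omega
      · have h6 : (k + Pi.single l z : Fin 4 → ℤ) 0 = k 0 := by simp [Ne.symm h]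
        rw [h6]
        split_ifs at * <;> omega
    rw [boxMap_apply]
    refine sum_sub_mem_of_mem 0 ?_ fun l hl => ?_
    · rw [h1]
      by_cases hk : 0 ≤ k 0
      · have h5 : outward 0 2 k = k + Pi.single 0 2 := by simp [outward, hk]
        have h6 := h4 0 (-2) (Or.inr rfl) (Or.inr (by simp [h5]))
        have h7 := Submodule.sub_mem _ h6 h3
        convert h7 using 1
        rw [h5]
        abel
      · have h5 : outward 0 2 k = k + Pi.single 0 (-2) := by simp [outward, hk]
        have h6 := h4 0 2 (Or.inl rfl) (Or.inr (by simp [h5]))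
        have h7 := Submodule.sub_mem _ h6 h3
        convert h7 using 1
        rw [h5]
        abel
    · rw [h1]
      exact Submodule.sub_mem _ (Submodule.add_mem _ (h4 l 2 (Or.inl rfl) (Or.inl hl))
        (h4 l (-2) (Or.inr rfl) (Or.inl hl))) h3

/-- The second summand is preferred, and within it the outward one of `δ_2`, `δ_2⁻¹`; a tie at `k 1
= 0` is broken by `3 > 1`. The sign of the leading coefficient depends on which one it is. The
exponent of `δ_1` stays in the gap left by `□`. -/
theorem isReductionSystem_symDiv [CharZero K] :
    IsReductionSystem symWeight
      (fun k : {k : Fin 4 → ℤ // -2 ≤ k 0 ∧ k 0 ≤ 1} => divMap (symmetricSym K) (mon K k.1))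
      fun k => (1, outward 1 1 k.1) := by
  refine .of_sub_mem ?_ fun ⟨k, hk⟩ => ⟨if 0 ≤ k 1 then 2⁻¹ else -2⁻¹, ?_, ?_⟩
  · rintro ⟨k, hk⟩ ⟨k', hk'⟩ h
    rw [Prod.mk.injEq] at h
    exact Subtype.ext (outward_injective 1 1 h.2)
  · split_ifs <;> simp
  · have h1 : ∀ l, comp l (mon K k * symmetricSym K l) = Finsupp.single (l, k + Pi.single l 1) 2⁻¹ -
        Finsupp.single (l, k + Pi.single l (-1)) 2⁻¹ := by
      intro l
      simp only [symmetricSym, mul_sub, smul_sub, AddMonoidAlgebra.single_mul_single,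
        AddMonoidAlgebra.smul_single, map_sub, comp_single, smul_eq_mul, mul_one, one_mul]
    have hsize : size (outward 1 1 k) = size k + 1 := size_outward 1 1 k
    have h0 := outward_apply_self 1 1 k
    have h2 := outward_apply_of_ne (zero_ne_one) 1 k
    have h4 : ∀ l z, z = 1 ∨ z = -1 → (l ≠ 1 ∨ outward 1 1 k ≠ k + Pi.single l z) →
        Finsupp.single (l, k + Pi.single l z) (2⁻¹ : K) ∈
        Finsupp.supported K K {t | symWeight t < symWeight (1, outward 1 1 k)} := by
      intro l z hz hl
      refine Finsupp.single_mem_supported _ _ (symWeight_lt.2 ?_)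
      have h5 := size_add_single k l z
      by_cases h : l = 1
      · subst h
        have h6 : z ≠ if 0 ≤ k 1 then 1 else -1 := by
          rintro rfl
          simp [outward] at hl
        have h7 : (k + Pi.single 1 z : Fin 4 → ℤ) 0 = k 0 := by simp
        simp only [h7, h2, Pi.add_apply, Pi.single_eq_same, lt_self_iff_false, false_or, true_and]
        push_cast at *
        split_ifs at * <;> omega
      · simp only [h, if_false, if_true, zero_lt_one, true_or, and_true]
        omega
    rw [divMap_apply]
    refine sum_sub_mem_of_mem 1 ?_ fun l hl => ?_
    · rw [h1]
      by_cases hk : 0 ≤ k 1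
      · have h5 : outward 1 1 k = k + Pi.single 1 1 := by simp [outward, hk]
        have h6 := h4 1 (-1) (Or.inr rfl) (Or.inr (by simp [h5]))
        convert Submodule.neg_mem _ h6 using 1
        rw [h5, if_pos hk]
        abel
      · have h5 : outward 1 1 k = k + Pi.single 1 (-1) := by simp [outward, hk]
        have h6 := h4 1 1 (Or.inl rfl) (Or.inr (by simp [h5]))
        convert h6 using 1
        rw [h5, if_neg hk, Finsupp.single_neg]
        abel
    · rw [h1]
      exact Submodule.sub_mem _ (h4 l 1 (Or.inl rfl) (Or.inl hl))
        (h4 l (-1) (Or.inr rfl) (Or.inl hl))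

theorem filtrationDim_symmetricSym [CharZero K]
    (hfin : ∀ r, {t : Fin 4 × (Fin 4 → ℤ) | size t.2 ≤ r}.Finite) (r : ℕ) :
    ∃ n : ℕ, filtrationDim (InvTerm.ord (m := 4) (s := 4)) (solModule (symmetricSym K)) r = n ∧
      n + {p : Fin 4 × (Fin 4 → ℤ) | size (outward 0 2 p.2) ≤ r}.ncard +
        {k : {k : Fin 4 → ℤ // -2 ≤ k 0 ∧ k 0 ≤ 1} | size (outward 1 1 k.1) ≤ r}.ncard =
        {t : Fin 4 × (Fin 4 → ℤ) | size t.2 ≤ r}.ncard := by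
  refine filtrationDim_solModule (μ := symWeight) (lm₀ := outward 0 2)
    (ord := fun t => size t.2)
    (fun t t' h => ?_) hfin isReductionSystem_symBox isReductionSystem_symDiv
    (fun j => divMap_mem _) (fun j => ?_) (fun W _ h k hk => ?_) r
  · by_contra! h1
    exact absurd h (not_le.2 (symWeight_lt.2 (Or.inl h1)))
  · rw [notMem_range_outward]
    simp only [outward_apply_of_ne zero_ne_one]
    exact j.2
  · exact h ⟨k, (notMem_range_outward k).1 hk⟩

end SymmetricReduction

/-! ### Leading terms for the forward scheme -/

section ForwardReduction

variable {K : Type*} [Field K]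

/-- The first index of a nonnegative entry (`3` if there is none). -/
def firstNonneg (k : Fin 4 → ℤ) : Fin 4 :=
  if 0 ≤ k 0 then 0 else if 0 ≤ k 1 then 1 else if 0 ≤ k 2 then 2 else 3

/-- The last index of a nonnegative entry (`0` if there is none). -/
def lastNonneg (k : Fin 4 → ℤ) : Fin 4 :=
  if 0 ≤ k 3 then 3 else if 0 ≤ k 2 then 2 else if 0 ≤ k 1 then 1 else 0

theorem neg_of_lt_firstNonneg {k : Fin 4 → ℤ} {l : Fin 4} (h : l < firstNonneg k) : k l < 0 := by
  unfold firstNonneg at h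
  split_ifs at h <;> fin_cases l <;> simp_all

/-- So the sign at `firstNonneg k` tells whether all entries are negative, whatever the default
index. -/
theorem neg_of_firstNonneg_neg {k : Fin 4 → ℤ} (h : k (firstNonneg k) < 0) (l : Fin 4) :
    k l < 0 := by
  unfold firstNonneg at h
  split_ifs at h <;> fin_cases l <;> simp_all <;> omega

theorem firstNonneg_eq {k : Fin 4 → ℤ} {j : Fin 4} (h : ∀ l < j, k l < 0) (hj : 0 ≤ k j) :
    firstNonneg k = j := by
  rcases lt_trichotomy (firstNonneg k) j with h1 | h1 | h1
  · exact absurd (neg_of_firstNonneg_neg (h _ h1) j) (not_lt.2 hj)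
  · exact h1
  · exact absurd (neg_of_lt_firstNonneg h1) (not_lt.2 hj)

theorem neg_of_lastNonneg_lt {k : Fin 4 → ℤ} {l : Fin 4} (h : lastNonneg k < l) : k l < 0 := by
  unfold lastNonneg at h
  split_ifs at h <;> fin_cases l <;> simp_all

theorem nonneg_lastNonneg {k : Fin 4 → ℤ} {l : Fin 4} (h : 0 ≤ k l) : 0 ≤ k (lastNonneg k) := by
  unfold lastNonneg
  split_ifs <;> first | assumption | (fin_cases l <;> simp_all <;> omega)

theorem lastNonneg_eq {k : Fin 4 → ℤ} {j : Fin 4} (h : ∀ l, j < l → k l < 0) (hj : 0 ≤ k j) :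
    lastNonneg k = j := by
  rcases lt_trichotomy (lastNonneg k) j with h1 | h1 | h1
  · exact absurd (neg_of_lastNonneg_lt h1) (not_lt.2 hj)
  · exact h1
  · exact absurd (nonneg_lastNonneg hj) (not_le.2 (h _ h1))

/-- The exponent of the leading term of `δ^k ∑_j (δ_j - 1)²`. -/
def boxLead (k : Fin 4 → ℤ) : Fin 4 → ℤ :=
  if 0 ≤ k (firstNonneg k) then k + Pi.single (firstNonneg k) 2 else k

theorem firstNonneg_add_single {k : Fin 4 → ℤ} {j : Fin 4} {z : ℤ}
    (hk : 0 ≤ k (firstNonneg k)) (hj : firstNonneg k ≤ j) (hz : 0 ≤ z) :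
    firstNonneg (k + Pi.single j z) = firstNonneg k := by
  apply firstNonneg_eq
  · intro l hl
    have h1 := neg_of_lt_firstNonneg hl
    rw [Pi.add_apply, Pi.single_eq_of_ne (hl.trans_le hj).ne, add_zero]
    exact h1
  · rw [Pi.add_apply]
    have : (0 : ℤ) ≤ (Pi.single j z : Fin 4 → ℤ) (firstNonneg k) := by
      rw [Pi.single_apply]
      split_ifs <;> simp [hz]
    omega

theorem firstNonneg_boxLead (k : Fin 4 → ℤ) : firstNonneg (boxLead k) = firstNonneg k := by
  unfold boxLead
  split_ifs with h
  · exact firstNonneg_add_single h le_rfl (by norm_num)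
  · rfl

/-- The shift preserves the first nonnegative index, and the sign of the entry there tells whether a
shift took place. -/
theorem boxLead_injective : Function.Injective boxLead := by
  intro k k' h
  have h1 : firstNonneg k = firstNonneg k' := by
    rw [← firstNonneg_boxLead, h, firstNonneg_boxLead]
  have h2 := congrFun h (firstNonneg k)
  unfold boxLead at h h2
  rw [← h1] at h h2
  split_ifs at h h2 with h3 h4 h4
  · exact add_right_cancel h
  · simp at h2
    omega
  · simp at h2
    omega
  · exact h

theorem notMem_range_boxLead (k : Fin 4 → ℤ) :
    k ∉ Set.range boxLead ↔ 0 ≤ k (firstNonneg k) ∧ k (firstNonneg k) ≤ 1 := by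
  constructor
  · intro h
    by_contra h1
    by_cases h2 : 0 ≤ k (firstNonneg k)
    · have h3 : firstNonneg (k + Pi.single (firstNonneg k) (-2)) = firstNonneg k := by
        apply firstNonneg_eq
        · intro l hl
          have := neg_of_lt_firstNonneg hl
          simpa [hl.ne]
        · simp
          omega
      refine h ⟨k + Pi.single (firstNonneg k) (-2), ?_⟩
      rw [boxLead, h3, if_pos, add_assoc, ← Pi.single_add]
      · simp
      · simp
        omega
    · exact h ⟨k, by rw [boxLead, if_neg h2]⟩
  · rintro h ⟨l, rfl⟩
    rw [firstNonneg_boxLead, boxLead] at h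
    split_ifs at h
    · simp at h
      omega
    · omega

/-- The first nonnegative entry, or `2` if there is none. -/
def firstValue (k : Fin 4 → ℤ) : ℕ :=
  if 0 ≤ k (firstNonneg k) then (k (firstNonneg k)).natAbs else 2

/-- Terms are compared by order, then by summand, then by the first nonnegative exponent. -/
def fwdWeight (t : Fin 4 × (Fin 4 → ℤ)) : ℕ ×ₗ ℕ ×ₗ ℕ :=
  toLex (size t.2, toLex (t.1.val, firstValue t.2))

theorem fwdWeight_lt {t t' : Fin 4 × (Fin 4 → ℤ)} :
    fwdWeight t < fwdWeight t' ↔ size t.2 < size t'.2 ∨ size t.2 = size t'.2 ∧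
      (t.1.val < t'.1.val ∨ t.1.val = t'.1.val ∧ firstValue t.2 < firstValue t'.2) := by
  simp only [fwdWeight, Prod.Lex.toLex_lt_toLex]

/-- The span of the terms that precede `t`. -/
def below (K : Type*) [Field K] (t : Fin 4 × (Fin 4 → ℤ)) :
    Submodule K (Fin 4 × (Fin 4 → ℤ) →₀ K) :=
  Finsupp.supported K K {t' | fwdWeight t' < fwdWeight t}

theorem single_mem_below_of_size_lt {t t' : Fin 4 × (Fin 4 → ℤ)} (h : size t'.2 < size t.2)
    (a : K) : Finsupp.single t' a ∈ below K t :=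
  Finsupp.single_mem_supported _ _ (fwdWeight_lt.2 (Or.inl h))

theorem single_mem_below {t t' : Fin 4 × (Fin 4 → ℤ)} (h : fwdWeight t' < fwdWeight t)
    (a : K) : Finsupp.single t' a ∈ below K t :=
  Finsupp.single_mem_supported _ _ h

theorem comp_mon_mul_forwardSym_sq (i l : Fin 4) (k : Fin 4 → ℤ) :
    comp i (mon K k * (forwardSym K l * forwardSym K l)) =
      Finsupp.single (i, k + Pi.single l 2) 1 - Finsupp.single (i, k + Pi.single l 1) 2 +
        Finsupp.single (i, k) 1 := by
  have h2 : mon K k * (forwardSym K l * forwardSym K l) =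
      AddMonoidAlgebra.single (k + Pi.single l 2) 1 -
      AddMonoidAlgebra.single (k + Pi.single l 1) (1 + 1) + AddMonoidAlgebra.single k 1 := by
    simp only [forwardSym, sub_mul, mul_sub, AddMonoidAlgebra.single_mul_single, ← Pi.single_add,
      mul_one, one_mul, AddMonoidAlgebra.single_add]
    norm_num
    abel
  rw [h2]
  norm_num

theorem comp_mon_mul_forwardSym (i l : Fin 4) (k : Fin 4 → ℤ) :
    comp i (mon K k * forwardSym K l) =
      Finsupp.single (i, k + Pi.single l 1) 1 - Finsupp.single (i, k) 1 := by
  simp [forwardSym, mul_sub, AddMonoidAlgebra.single_mul_single]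

theorem comp_mon_mul_forwardSym_mul (i j l : Fin 4) (k : Fin 4 → ℤ) :
    comp i (mon K k * (forwardSym K j * forwardSym K l)) =
      Finsupp.single (i, k + Pi.single j 1 + Pi.single l 1) 1 -
        Finsupp.single (i, k + Pi.single j 1) 1 -
        (Finsupp.single (i, k + Pi.single l 1) 1 - Finsupp.single (i, k) 1) := by
  have h1 : mon K k * (forwardSym K j * forwardSym K l) =
      mon K (k + Pi.single j 1) * forwardSym K l - mon K k * forwardSym K l := by
    rw [← sub_mul, ← mul_assoc]
    congr 1
    simp [forwardSym, mul_sub, AddMonoidAlgebra.single_mul_single]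
  rw [h1, map_sub, comp_mon_mul_forwardSym, comp_mon_mul_forwardSym]

/-- If `k` has a nonnegative entry, the order rises by `2` only at nonnegative entries. Raising a
later one leaves the first such entry unchanged, so raising the first one wins. If all entries are
negative, nothing exceeds the order of `δ^k`, which occurs once for each of the four squares, hence
with coefficient `4`. -/
theorem isReductionSystem_fwdBox [CharZero K] :
    IsReductionSystem fwdWeight
      (fun p : Fin 4 × (Fin 4 → ℤ) => boxMap (forwardSym K) p.1 (mon K p.2))
      fun p => (p.1, boxLead p.2) := by
  refine .of_sub_mem ?_ fun ⟨i, k⟩ => ⟨if 0 ≤ k (firstNonneg k) then 1 else 4, ?_, ?_⟩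
  · rintro ⟨i, k⟩ ⟨i', k'⟩ h
    rw [Prod.mk.injEq] at h
    exact Prod.ext h.1 (boxLead_injective h.2)
  · split_ifs <;> simp
  change _ ∈ below K (i, boxLead k)
  rw [boxMap_apply]
  simp only [comp_mon_mul_forwardSym_sq]
  have h1 := fun l => size_add_single k l 1
  have h2 := fun l => size_add_single k l 2
  by_cases hk : 0 ≤ k (firstNonneg k)
  · have hlead : boxLead k = k + Pi.single (firstNonneg k) 2 := if_pos hk
    have hsize : size (boxLead k) = size k + 2 := by
      have h3 := h2 (firstNonneg k)
      rw [hlead]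
      omega
    rw [if_pos hk]
    refine sum_sub_mem_of_mem (firstNonneg k) ?_ fun l hl => ?_
    · rw [← hlead, add_sub_right_comm, sub_right_comm, sub_self, zero_sub]
      refine Submodule.add_mem _ (Submodule.neg_mem _ (single_mem_below_of_size_lt ?_ _))
        (single_mem_below_of_size_lt ?_ _)
      · have := h1 (firstNonneg k)
        simp only
        omega
      · simp only
        omega
    · refine Submodule.add_mem _ (Submodule.sub_mem _ (single_mem_below (fwdWeight_lt.2 ?_) _)
        (single_mem_below_of_size_lt ?_ _)) (single_mem_below_of_size_lt ?_ _)
      · by_cases hkl : 0 ≤ k l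
        · have hlt : firstNonneg k < l := by
            rcases lt_trichotomy (firstNonneg k) l with h3 | h3 | h3
            · exact h3
            · exact absurd h3.symm hl
            · exact absurd (neg_of_lt_firstNonneg h3) (not_lt.2 hkl)
          refine Or.inr ⟨?_, Or.inr ⟨rfl, ?_⟩⟩
          · have := h2 l
            simp only
            omega
          · have h3 : firstNonneg (k + Pi.single l 2) = firstNonneg k :=
              firstNonneg_add_single hk hlt.le (by norm_num)
            have h4 : (k + Pi.single l 2 : Fin 4 → ℤ) (firstNonneg k) = k (firstNonneg k) := by
              simp [hl.symm]
            have h5 : boxLead k (firstNonneg k) = k (firstNonneg k) + 2 := by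
              simp [hlead]
            simp only [firstValue, h3, h4, firstNonneg_boxLead, h5]
            split_ifs <;> omega
        · left
          have := h2 l
          simp only
          omega
      · have := h1 l
        simp only
        omega
      · simp only
        omega
  · have hlead : boxLead k = k := if_neg hk
    have hneg := neg_of_firstNonneg_neg (not_le.1 hk)
    have h4 : Finsupp.single (i, k) (4 : K) = ∑ l : Fin 4, Finsupp.single (i, k) 1 := by
      simp
    rw [if_neg hk]
    simp only [hlead]
    rw [h4, ← Finset.sum_sub_distrib]
    refine Submodule.sum_mem _ fun l _ => ?_
    rw [add_sub_cancel_right]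
    have hl := hneg l
    refine Submodule.sub_mem _ (single_mem_below (fwdWeight_lt.2 ?_) _)
        (single_mem_below_of_size_lt ?_ _)
    · have h5 := h2 l
      -- Passing from `-1` to `1` keeps the order. The tie is decided by the first nonnegative
      -- entry, now `1`, against the default value `2` of `firstValue` for the all-negative `k`.
      by_cases h6 : k l = -1
      · have h7 : firstNonneg (k + Pi.single l 2) = l := by
          apply firstNonneg_eq
          · intro l' hl'
            have := hneg l'
            simpa [hl'.ne]
          · simp [h6]
        have h8 : (k + Pi.single l 2 : Fin 4 → ℤ) l = 1 := by
          simp [h6]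
        refine Or.inr ⟨?_, Or.inr ⟨rfl, ?_⟩⟩
        · simp only
          omega
        · simp only [firstValue, h7, h8, if_neg hk]
          norm_num
      · left
        simp only
        omega
    · have := h1 l
      simp only
      omega

/-- Exponents with one entry `1` and all others negative. -/
def IsExceptional (k : Fin 4 → ℤ) : Prop :=
  k (firstNonneg k) = 1 ∧ lastNonneg k = firstNonneg k

instance (k : Fin 4 → ℤ) : Decidable (IsExceptional k) :=
  inferInstanceAs (Decidable (_ ∧ _))

theorem IsExceptional.neg {k : Fin 4 → ℤ} (h : IsExceptional k) {l : Fin 4}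
    (hl : l ≠ firstNonneg k) : k l < 0 := by
  rcases lt_or_gt_of_ne hl with h1 | h1
  · exact neg_of_lt_firstNonneg h1
  · exact neg_of_lastNonneg_lt (h.2.symm ▸ h1)

/-- The last index different from `j`. -/
def otherIndex (j : Fin 4) : Fin 4 := if j = 3 then 2 else 3

theorem otherIndex_ne (j : Fin 4) : otherIndex j ≠ j := by
  unfold otherIndex
  split_ifs with h
  · subst h
    decide
  · exact Ne.symm h

theorem lt_otherIndex {j l : Fin 4} (h : l ≠ j) (h' : l ≠ otherIndex j) : l < otherIndex j := by
  revert j l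
  decide

/-- The relations complementing the multiples of the `□ e_i`. -/
noncomputable def fwdRel (K : Type*) [Field K] (k : Fin 4 → ℤ) : Fin 4 × (Fin 4 → ℤ) →₀ K :=
  if IsExceptional k then
    boxMap (forwardSym K) (firstNonneg k) (mon K (k + Pi.single (firstNonneg k) (-1))) -
      divMap (forwardSym K)
        (mon K (k + Pi.single (firstNonneg k) (-1)) * forwardSym K (firstNonneg k))
  else divMap (forwardSym K) (mon K k)

/-- The leading terms of the relations `fwdRel`. -/
def fwdLead (k : Fin 4 → ℤ) : Fin 4 × (Fin 4 → ℤ) :=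
  if IsExceptional k then (otherIndex (firstNonneg k), k)
  else (lastNonneg k, k + Pi.single (lastNonneg k) 1)

/-- An exceptional leading term has a negative exponent at the index of its own summand, whereas a
regular one has a positive exponent there. -/
theorem fwdLead_injOn {k k' : Fin 4 → ℤ} (hk : 0 ≤ k (firstNonneg k))
    (hk' : 0 ≤ k' (firstNonneg k')) (h : fwdLead k = fwdLead k') : k = k' := by
  have aux : ∀ {k k' : Fin 4 → ℤ}, 0 ≤ k' (firstNonneg k') → IsExceptional k →
      (otherIndex (firstNonneg k), k) ≠ (lastNonneg k', k' + Pi.single (lastNonneg k') 1) := by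
    intro k k' hk' h1 h2
    rw [Prod.mk.injEq] at h2
    have h3 := h1.neg (otherIndex_ne _)
    rw [h2.1, congrFun h2.2] at h3
    have := nonneg_lastNonneg hk'
    simp at h3
    omega
  unfold fwdLead at h
  split_ifs at h with h1 h2 h2
  · exact (Prod.ext_iff.1 h).2
  · exact absurd h (aux hk' h1)
  · exact absurd h.symm (aux hk h2)
  · rw [Prod.mk.injEq] at h
    rw [h.1] at h
    exact add_right_cancel h.2

theorem size_fwdLead {k : Fin 4 → ℤ} (hk : 0 ≤ k (firstNonneg k)) :
    size (fwdLead k).2 = size k + if IsExceptional k then 0 else 1 := by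
  unfold fwdLead
  split_ifs
  · rfl
  · have := size_add_single k (lastNonneg k) 1
    have := nonneg_lastNonneg hk
    simp only
    omega

/-- For regular `k`, multiplication by `δ_l` raises the order only where `k l ≥ 0`, and the last
such summand leads. For exceptional `k` with entry `1` at `j`, the leading term of `δ^k w` would
have entry `2` there and also lead a multiple of `□ e_j`. The relation `fwdRel` is the difference in
which these leading terms cancel. -/
theorem isReductionSystem_fwdRel [CharZero K] :
    IsReductionSystem fwdWeight
      (fun k : {k : Fin 4 → ℤ // 0 ≤ k (firstNonneg k) ∧ k (firstNonneg k) ≤ 1} => fwdRel K k.1)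
      fun k => fwdLead k.1 := by
  refine .of_sub_mem ?_ fun ⟨k, hk⟩ => ⟨1, one_ne_zero, ?_⟩
  · rintro ⟨k, hk⟩ ⟨k', hk'⟩ h
    exact Subtype.ext (fwdLead_injOn hk.1 hk'.1 h)
  change _ ∈ below K (fwdLead k)
  simp only
  have hsize := size_fwdLead hk.1
  by_cases hex : IsExceptional k
  · obtain ⟨j, hj⟩ : ∃ j, j = firstNonneg k := ⟨_, rfl⟩
    obtain ⟨k', hk'⟩ : ∃ k', k' = k + Pi.single j (-1) := ⟨_, rfl⟩
    have hkk : k' + Pi.single j 1 = k := by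
      rw [hk', add_assoc, ← Pi.single_add]
      simp
    have hlead : fwdLead k = (otherIndex j, k) := by
      rw [fwdLead, if_pos hex, hj]
    rw [if_pos hex, add_zero] at hsize
    have h0 : k j = 1 := hj ▸ hex.1
    have hk'j : k' j = 0 := by
      simp [hk', h0]
    have hneg : ∀ l, l ≠ j → k' l < 0 := by
      intro l hl
      have h3 := hex.neg (hj ▸ hl)
      simpa [hk', hl] using h3
    have hs' := size_add_single k' j 1
    rw [hkk, hk'j] at hs'
    have hs1 := fun l => size_add_single k' l 1
    have hs2 := fun l => size_add_single k' l 2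
    have hs3 := fun l => size_add_single k l 1
    -- In `δ^{k'} ∑_l (D_l² e_j - D_j D_l e_l)` the summand `l = j` vanishes. For `l ≠ j` the
    -- exponent at `l` is negative, so `δ_l` lowers the order, and only `δ^{k'} δ_j e_l = δ^k e_l`
    -- keeps the full order of `k`. The greatest `l ≠ j` leads, with coefficient `1`.
    rw [hlead, fwdRel, if_pos hex, ← hj, ← hk', ← potential_eq]
    refine sum_sub_mem_of_mem (otherIndex j) ?_ fun l hl => ?_
    all_goals rw [comp_mon_mul_forwardSym_sq, comp_mon_mul_forwardSym_mul, hkk]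
    · have h5 := hneg _ (otherIndex_ne j)
      have h6 : k (otherIndex j) < 0 := hex.neg (hj ▸ otherIndex_ne j)
      have hs1 := hs1 (otherIndex j)
      have hs2 := hs2 (otherIndex j)
      have hs3 := hs3 (otherIndex j)
      have h7 : ∀ (i : Fin 4) (m : Fin 4 → ℤ) (a : K), size m < size k →
          Finsupp.single (i, m) a ∈ below K (otherIndex j, k) := fun i m a h =>
        single_mem_below_of_size_lt h a
      have h8 := Submodule.sub_mem _ (Submodule.add_mem _ (Submodule.sub_mem _
        (h7 j (k' + Pi.single (otherIndex j) 2) 1 (by omega))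
        (h7 j (k' + Pi.single (otherIndex j) 1) 2 (by omega))) (h7 j k' 1 (by omega)))
        (Submodule.sub_mem _ (h7 (otherIndex j) (k + Pi.single (otherIndex j) 1) 1 (by omega))
          (Submodule.sub_mem _ (h7 (otherIndex j) (k' + Pi.single (otherIndex j) 1) 1 (by omega))
            (h7 (otherIndex j) k' 1 (by omega))))
      convert h8 using 1
      abel
    · by_cases hlj : l = j
      · subst hlj
        have h9 : k + Pi.single l 1 = k' + Pi.single l 2 := by
          rw [← hkk, add_assoc, ← Pi.single_add]
          norm_num
        have h10 : Finsupp.single (l, k) (2 : K) =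
            Finsupp.single (l, k) 1 + Finsupp.single (l, k) 1 := by
          rw [← Finsupp.single_add]
          norm_num
        rw [hkk, h9, h10]
        convert Submodule.zero_mem _ using 1
        abel
      · have h5 := hneg _ hlj
        have h6 : k l < 0 := hex.neg (hj ▸ hlj)
        have hs1 := hs1 l
        have hs2 := hs2 l
        have hs3 := hs3 l
        have h7 : ∀ (i : Fin 4) (m : Fin 4 → ℤ) (a : K), size m < size k →
            Finsupp.single (i, m) a ∈ below K (otherIndex j, k) := fun i m a h =>
          single_mem_below_of_size_lt h a
        refine Submodule.sub_mem _ (Submodule.add_mem _ (Submodule.sub_mem _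
          (h7 _ _ _ (by omega)) (h7 _ _ _ (by omega))) (h7 _ _ _ (by omega)))
          (Submodule.sub_mem _ (Submodule.sub_mem _ (h7 _ _ _ (by omega)) ?_)
            (Submodule.sub_mem _ (h7 _ _ _ (by omega)) (h7 _ _ _ (by omega))))
        have h11 : fwdWeight (l, k) < fwdWeight (otherIndex j, k) :=
          fwdWeight_lt.2 (Or.inr ⟨rfl, Or.inl (lt_otherIndex hlj hl)⟩)
        exact single_mem_below h11 _
  · have hlead : fwdLead k = (lastNonneg k, k + Pi.single (lastNonneg k) 1) := if_neg hex
    rw [if_neg hex] at hsize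
    rw [fwdRel, if_neg hex, divMap_apply]
    simp only [comp_mon_mul_forwardSym]
    refine sum_sub_mem_of_mem (lastNonneg k) ?_ fun l hl => ?_
    · rw [← hlead, sub_sub_cancel_left]
      exact Submodule.neg_mem _ (single_mem_below_of_size_lt (by simp only; omega) _)
    · refine Submodule.sub_mem _ (single_mem_below (fwdWeight_lt.2 ?_) _)
        (single_mem_below_of_size_lt (by simp only; omega) _)
      have h1 := size_add_single k l 1
      by_cases hkl : 0 ≤ k l
      · refine Or.inr ⟨by simp only; omega, Or.inl ?_⟩
        rw [hlead]
        rcases lt_trichotomy l (lastNonneg k) with h3 | h3 | h3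
        · exact h3
        · exact absurd h3 hl
        · exact absurd (neg_of_lastNonneg_lt h3) (not_lt.2 hkl)
      · left
        simp only
        omega

theorem filtrationDim_forwardSym [CharZero K]
    (hfin : ∀ r, {t : Fin 4 × (Fin 4 → ℤ) | size t.2 ≤ r}.Finite) (r : ℕ) :
    ∃ n : ℕ, filtrationDim (InvTerm.ord (m := 4) (s := 4)) (solModule (forwardSym K)) r = n ∧
      n + {p : Fin 4 × (Fin 4 → ℤ) | size (boxLead p.2) ≤ r}.ncard +
        {k : {k : Fin 4 → ℤ // 0 ≤ k (firstNonneg k) ∧ k (firstNonneg k) ≤ 1} |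
          size (fwdLead k.1).2 ≤ r}.ncard =
        {t : Fin 4 × (Fin 4 → ℤ) | size t.2 ≤ r}.ncard := by
  refine filtrationDim_solModule (μ := fwdWeight) (lm₀ := boxLead)
    (ord := fun t => size t.2)
    (fun t t' h => ?_) hfin isReductionSystem_fwdBox isReductionSystem_fwdRel
    (fun j => ?_) (fun j => ?_) (fun W hbox h k hk => ?_) r
  · by_contra! h1
    exact absurd h (not_le.2 (fwdWeight_lt.2 (Or.inl h1)))
  · simp only [fwdRel]
    split_ifs
    · exact Submodule.sub_mem _ (boxMap_mem _ _) (divMap_mem _)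
    · exact divMap_mem _
  · obtain ⟨k, hk⟩ := j
    rw [notMem_range_boxLead]
    simp only [fwdLead]
    split_ifs with hex
    · exact hk
    · have h0 := nonneg_lastNonneg hk.1
      have hle : firstNonneg k ≤ lastNonneg k := by
        by_contra! h1
        exact absurd (neg_of_lt_firstNonneg h1) (not_lt.2 h0)
      simp only [firstNonneg_add_single hk.1 hle zero_le_one, Pi.add_apply, Pi.single_apply]
      split_ifs with h1
      · have h2 : k (firstNonneg k) ≠ 1 := fun h2 => hex ⟨h2, h1.symm⟩
        omega
      · omega
  · rw [notMem_range_boxLead] at hk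
    by_cases hex : IsExceptional k
    · have h1 := h ⟨k, hk⟩
      simp only [fwdRel, if_pos hex] at h1
      obtain ⟨j, hj⟩ : ∃ j, j = firstNonneg k := ⟨_, rfl⟩
      obtain ⟨k', hk'⟩ : ∃ k', k' = k + Pi.single j (-1) := ⟨_, rfl⟩
      have hkk : k' + Pi.single j 1 = k := by
        rw [hk', add_assoc, ← Pi.single_add]
        simp
      have h0 : k j = 1 := hj ▸ hex.1
      have hk'j : k' j = 0 := by
        simp [hk', h0]
      have hfirst : firstNonneg k' = j := by
        refine firstNonneg_eq (fun l hl => ?_) hk'j.ge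
        have h3 := neg_of_lt_firstNonneg (hj ▸ hl)
        simpa [hk', hl.ne] using h3
      have h2 := h ⟨k', by rw [hfirst, hk'j]; simp⟩
      have hex' : ¬ IsExceptional k' := by
        intro h3
        have h4 := h3.1
        rw [hfirst, hk'j] at h4
        exact zero_ne_one h4
      simp only [fwdRel, if_neg hex'] at h2
      rw [← hj, ← hk', Submodule.sub_mem_iff_right _ (hbox _ _), forwardSym, mul_sub, mul_one,
        map_sub, AddMonoidAlgebra.single_mul_single, mul_one, hkk,
        Submodule.sub_mem_iff_left _ h2] at h1
      exact h1
    · have h1 := h ⟨k, hk⟩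
      simpa only [fwdRel, if_neg hex] using h1

end ForwardReduction

/-! ### Counting exponents -/

section Counting

variable {α : Type*} {w : α → ℕ}

/-- The exponent vectors of length `n` with entries in `S` and total weight `r`. -/
def sphere (S : Set α) (w : α → ℕ) (n r : ℕ) : Set (Fin n → α) :=
  {k | (∀ i, k i ∈ S) ∧ ∑ i, w (k i) = r}

/-- The exponent vectors of length `n` with entries in `S` and total weight at most `r`. -/
def ball (S : Set α) (w : α → ℕ) (n r : ℕ) : Set (Fin n → α) :=
  {k | (∀ i, k i ∈ S) ∧ ∑ i, w (k i) ≤ r}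

theorem finite_ball (hw : ∀ r, {a | w a ≤ r}.Finite) (S : Set α) (n r : ℕ) :
    (ball S w n r).Finite := by
  refine (Set.Finite.pi' (t := fun _ : Fin n => {a | w a ≤ r}) fun _ => hw r).subset ?_
  rintro k ⟨_, hk⟩ i
  exact (Finset.single_le_sum (f := fun i => w (k i)) (fun _ _ => Nat.zero_le _)
    (Finset.mem_univ i)).trans hk

theorem finite_sphere (hw : ∀ r, {a | w a ≤ r}.Finite) (S : Set α) (n r : ℕ) :
    (sphere S w n r).Finite :=
  (finite_ball hw S n r).subset fun _ hk => ⟨hk.1, hk.2.le⟩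

theorem ncard_ball_succ (hw : ∀ r, {a | w a ≤ r}.Finite) (S : Set α) (n r : ℕ) :
    (ball S w n (r + 1)).ncard = (ball S w n r).ncard + (sphere S w n (r + 1)).ncard := by
  rw [← Set.ncard_union_eq _ (finite_ball hw S n r) (finite_sphere hw S n (r + 1))]
  · congr 1
    ext k
    simp only [ball, sphere, Set.mem_union, Set.mem_ofPred_eq, ← and_or_left,
      Nat.le_succ_iff]
  · rw [Set.disjoint_left]
    rintro k h1 h2
    have := h1.2
    have := h2.2
    omega

theorem ball_zero (S : Set α) (n : ℕ) : ball S w n 0 = sphere S w n 0 := by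
  simp only [ball, sphere, Nat.le_zero]

theorem ncard_sphere_zero_left_zero (S : Set α) : (sphere S w 0 0).ncard = 1 := by
  have h1 : sphere S w 0 0 = Set.univ := by
    ext k
    simp [sphere]
  rw [h1, Set.ncard_univ, Nat.card_unique]

theorem ncard_sphere_zero_left_succ (S : Set α) (r : ℕ) : (sphere S w 0 (r + 1)).ncard = 0 := by
  have h1 : sphere S w 0 (r + 1) = ∅ := by
    ext k
    simp [sphere]
  rw [h1, Set.ncard_empty]

theorem ncard_sphere_succ_left (hw : ∀ r, {a | w a ≤ r}.Finite) (S : Set α) (n r : ℕ) :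
    (sphere S w (n + 1) r).ncard =
      ∑ i ∈ Finset.range (r + 1), {a | a ∈ S ∧ w a = i}.ncard * (sphere S w n (r - i)).ncard := by
  have h1 : sphere S w (n + 1) r = ⋃ i ∈ Finset.range (r + 1),
      (Fin.consEquiv fun _ => α) '' ({a | a ∈ S ∧ w a = i} ×ˢ sphere S w n (r - i)) := by
    ext k
    simp only [Set.mem_iUnion, Set.mem_image, Finset.mem_range]
    constructor
    · rintro ⟨hS, hk⟩
      rw [Fin.sum_univ_succ] at hk
      refine ⟨w (k 0), by omega, (k 0, fun i => k i.succ), ⟨⟨hS 0, rfl⟩, fun i => hS _, ?_⟩, ?_⟩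
      · simp only
        omega
      · exact Fin.cons_self_tail k
    · rintro ⟨i, hi, ⟨a, l⟩, ⟨⟨ha, hai⟩, hl, hli⟩, rfl⟩
      simp only at ha hai hl hli
      refine ⟨Fin.cases ha hl, ?_⟩
      rw [Fin.sum_univ_succ]
      simp only [Fin.consEquiv_apply, Fin.cons_zero, Fin.cons_succ]
      omega
  have hfin : ∀ i, {a | a ∈ S ∧ w a = i}.Finite := fun i =>
    (hw i).subset fun a ha => ha.2.le
  have hd : ((Finset.range (r + 1) : Finset ℕ) : Set ℕ).PairwiseDisjoint fun i =>
      (Fin.consEquiv fun _ => α) '' ({a | a ∈ S ∧ w a = i} ×ˢ sphere S w n (r - i)) := by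
    intro i _ j _ hij
    refine Set.disjoint_left.2 ?_
    rintro _ ⟨⟨a, l⟩, ⟨⟨_, ha⟩, _⟩, rfl⟩ ⟨⟨b, l'⟩, ⟨⟨_, hb⟩, _⟩, h2⟩
    have h3 := (Fin.consEquiv fun _ => α).injective h2
    simp only [Prod.mk.injEq] at h3 ha hb
    exact hij (ha.symm.trans ((congrArg w h3.1).symm.trans hb))
  rw [h1]
  refine ((Finset.finite_toSet _).ncard_biUnion
    (fun i _ => ((hfin i).prod (finite_sphere hw S n (r - i))).image _) hd).trans ?_
  simp only [finsum_mem_coe_finset]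
  refine Finset.sum_congr rfl fun i _ => ?_
  rw [Set.ncard_image_of_injective _ (Fin.consEquiv fun _ => α).injective, Set.ncard_prod]

/-- If `a` letters have weight `0` and `b` letters each positive weight, then the numbers of
vectors satisfy a recursion. -/
theorem ncard_sphere_succ_succ (hw : ∀ r, {a | w a ≤ r}.Finite) {S : Set α} {a b : ℕ}
    (h0 : {x | x ∈ S ∧ w x = 0}.ncard = a) (hs : ∀ i, {x | x ∈ S ∧ w x = i + 1}.ncard = b)
    (n r : ℕ) :
    (sphere S w (n + 1) (r + 1)).ncard + a * (sphere S w n r).ncard =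
      (sphere S w (n + 1) r).ncard + b * (sphere S w n r).ncard +
        a * (sphere S w n (r + 1)).ncard := by
  have h1 : (sphere S w (n + 1) (r + 1)).ncard =
      b * ∑ i ∈ Finset.range (r + 1), (sphere S w n (r - i)).ncard +
        a * (sphere S w n (r + 1)).ncard := by
    rw [ncard_sphere_succ_left hw, Finset.sum_range_succ', h0, Finset.mul_sum]
    simp only [hs, Nat.sub_zero, Nat.reduceSubDiff]
  have h2 : (sphere S w (n + 1) r).ncard + b * (sphere S w n r).ncard =
      b * ∑ i ∈ Finset.range (r + 1), (sphere S w n (r - i)).ncard +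
        a * (sphere S w n r).ncard := by
    rw [ncard_sphere_succ_left hw, Finset.sum_range_succ', Finset.sum_range_succ', h0, mul_add,
      Finset.mul_sum]
    simp only [hs, Nat.sub_zero]
    ring
  rw [h1, h2]
  ring

theorem ncard_sphere_zero_right (hw : ∀ r, {a | w a ≤ r}.Finite) {S : Set α} {a : ℕ}
    (h0 : {x | x ∈ S ∧ w x = 0}.ncard = a) (n : ℕ) : (sphere S w n 0).ncard = a ^ n := by
  induction n with
  | zero => rw [ncard_sphere_zero_left_zero, pow_zero]
  | succ n ih => simp [ncard_sphere_succ_left hw, h0, ih, pow_succ']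

end Counting

/-! ### Lattice points in spheres and balls -/

section Numbers

theorem finite_natAbs_le (r : ℕ) : {z : ℤ | z.natAbs ≤ r}.Finite := by
  refine (Set.finite_Icc (-r : ℤ) r).subset fun z hz => ?_
  rw [Set.mem_ofPred_eq] at hz
  rw [Set.mem_Icc]
  omega

/-! #### Exponents in `ℕ` -/

theorem nat_sphere_succ (n r : ℕ) :
    (sphere Set.univ id (n + 1) (r + 1)).ncard =
      (sphere Set.univ id (n + 1) r).ncard + (sphere Set.univ id n (r + 1)).ncard := by
  have h1 : ∀ i : ℕ, {x : ℕ | x ∈ Set.univ ∧ id x = i}.ncard = 1 := by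
    intro i
    simp
  have h2 := ncard_sphere_succ_succ (w := id) (fun r => Set.finite_Iic r) (h1 0)
    (fun i => h1 (i + 1)) n r
  omega

theorem nat_sphere_zero (n : ℕ) : (sphere (Set.univ : Set ℕ) id n 0).ncard = 1 := by
  rw [ncard_sphere_zero_right (w := id) (fun r => Set.finite_Iic r) (a := 1) (by simp), one_pow]

theorem nat_sphere_one (r : ℕ) : (sphere (Set.univ : Set ℕ) id 1 r).ncard = 1 := by
  induction r with
  | zero => exact nat_sphere_zero 1
  | succ r ih => rw [nat_sphere_succ, ih, ncard_sphere_zero_left_succ]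

theorem nat_sphere_two (r : ℕ) : (sphere (Set.univ : Set ℕ) id 2 r).ncard = r + 1 := by
  induction r with
  | zero => exact nat_sphere_zero 2
  | succ r ih => rw [nat_sphere_succ, ih, nat_sphere_one]

theorem nat_sphere_three (r : ℕ) :
    ((sphere (Set.univ : Set ℕ) id 3 r).ncard : ℚ) = (r + 1) * (r + 2) / 2 := by
  induction r with
  | zero => rw [nat_sphere_zero]; norm_num
  | succ r ih =>
    rw [nat_sphere_succ, nat_sphere_two]
    push_cast
    rw [ih]
    ring

theorem nat_sphere_four (r : ℕ) :
    ((sphere (Set.univ : Set ℕ) id 4 r).ncard : ℚ) = (r + 1) * (r + 2) * (r + 3) / 6 := by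
  induction r with
  | zero => rw [nat_sphere_zero]; norm_num
  | succ r ih =>
    rw [nat_sphere_succ]
    push_cast
    rw [ih, nat_sphere_three]
    push_cast
    ring

theorem nat_ball_four (r : ℕ) :
    ((ball (Set.univ : Set ℕ) id 4 r).ncard : ℚ) = (r + 1) * (r + 2) * (r + 3) * (r + 4) / 24 := by
  induction r with
  | zero => rw [ball_zero, nat_sphere_zero]; norm_num
  | succ r ih =>
    rw [ncard_ball_succ (w := id) fun r => Set.finite_Iic r]
    push_cast
    rw [ih, nat_sphere_four]
    push_cast
    ring

/-! #### Exponents in `ℤ` -/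

theorem int_sphere_succ (n r : ℕ) :
    (sphere Set.univ Int.natAbs (n + 1) (r + 1)).ncard =
      (sphere Set.univ Int.natAbs (n + 1) r).ncard + (sphere Set.univ Int.natAbs n r).ncard +
        (sphere Set.univ Int.natAbs n (r + 1)).ncard := by
  have h1 : {x : ℤ | x ∈ Set.univ ∧ x.natAbs = 0}.ncard = 1 := by
    simp
  have h2 : ∀ i : ℕ, {x : ℤ | x ∈ Set.univ ∧ x.natAbs = i + 1}.ncard = 2 := by
    intro i
    have h3 : {x : ℤ | x ∈ Set.univ ∧ x.natAbs = i + 1} = {(i + 1 : ℤ), -(i + 1 : ℤ)} := by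
      ext x
      simp only [Set.mem_univ, true_and, Set.mem_ofPred_eq, Set.mem_insert_iff,
        Set.mem_singleton_iff]
      omega
    rw [h3, Set.ncard_pair (by omega)]
  have h3 := ncard_sphere_succ_succ finite_natAbs_le h1 h2 n r
  omega

theorem int_sphere_zero (n : ℕ) : (sphere (Set.univ : Set ℤ) Int.natAbs n 0).ncard = 1 := by
  rw [ncard_sphere_zero_right finite_natAbs_le (a := 1) (by simp), one_pow]

theorem int_sphere_one (r : ℕ) :
    (sphere (Set.univ : Set ℤ) Int.natAbs 1 (r + 1)).ncard = 2 := by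
  induction r with
  | zero =>
    rw [int_sphere_succ, int_sphere_zero, int_sphere_zero, ncard_sphere_zero_left_succ]
  | succ r ih =>
    rw [int_sphere_succ, ih, ncard_sphere_zero_left_succ, ncard_sphere_zero_left_succ]

theorem int_sphere_two (r : ℕ) :
    (sphere (Set.univ : Set ℤ) Int.natAbs 2 (r + 1)).ncard = 4 * (r + 1) := by
  induction r with
  | zero => rw [int_sphere_succ, int_sphere_zero, int_sphere_zero, int_sphere_one]
  | succ r ih =>
    rw [int_sphere_succ, ih, int_sphere_one, int_sphere_one]
    ring

theorem int_sphere_three (r : ℕ) :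
    (sphere (Set.univ : Set ℤ) Int.natAbs 3 (r + 1)).ncard = 4 * (r + 1) ^ 2 + 2 := by
  induction r with
  | zero =>
    rw [int_sphere_succ, int_sphere_zero, int_sphere_zero, int_sphere_two]
    norm_num
  | succ r ih =>
    rw [int_sphere_succ, ih, int_sphere_two, int_sphere_two]
    ring

theorem int_sphere_four (r : ℕ) :
    ((sphere (Set.univ : Set ℤ) Int.natAbs 4 (r + 1)).ncard : ℚ) =
      8 * ((r + 1) ^ 3 + 2 * (r + 1)) / 3 := by
  induction r with
  | zero =>
    rw [int_sphere_succ, int_sphere_zero, int_sphere_zero, int_sphere_three]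
    norm_num
  | succ r ih =>
    rw [int_sphere_succ, int_sphere_three, int_sphere_three]
    push_cast
    rw [ih]
    ring

theorem int_ball_four (r : ℕ) :
    ((ball (Set.univ : Set ℤ) Int.natAbs 4 r).ncard : ℚ) =
      1 + 2 / 3 * r ^ 2 * (r + 1) ^ 2 + 8 / 3 * r * (r + 1) := by
  induction r with
  | zero => rw [ball_zero, int_sphere_zero]; norm_num
  | succ r ih =>
    rw [ncard_ball_succ finite_natAbs_le]
    push_cast
    rw [ih, int_sphere_four]
    ring

/-! #### Negative exponents -/

theorem neg_sphere_succ (n r : ℕ) :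
    (sphere (Set.Iio 0) Int.natAbs (n + 1) (r + 1)).ncard =
      (sphere (Set.Iio 0) Int.natAbs (n + 1) r).ncard +
        (sphere (Set.Iio 0) Int.natAbs n r).ncard := by
  have h1 : {x : ℤ | x ∈ Set.Iio 0 ∧ x.natAbs = 0}.ncard = 0 := by
    have h3 : {x : ℤ | x ∈ Set.Iio 0 ∧ x.natAbs = 0} = ∅ := by
      rw [Set.eq_empty_iff_forall_notMem]
      rintro x ⟨h1, h2⟩
      rw [Set.mem_Iio] at h1
      omega
    rw [h3, Set.ncard_empty]
  have h2 : ∀ i : ℕ, {x : ℤ | x ∈ Set.Iio 0 ∧ x.natAbs = i + 1}.ncard = 1 := by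
    intro i
    have h3 : {x : ℤ | x ∈ Set.Iio 0 ∧ x.natAbs = i + 1} = {-(i + 1 : ℤ)} := by
      ext x
      simp only [Set.mem_Iio, Set.mem_ofPred_eq, Set.mem_singleton_iff]
      omega
    rw [h3, Set.ncard_singleton]
  have h3 := ncard_sphere_succ_succ finite_natAbs_le h1 h2 n r
  omega

theorem neg_sphere_zero (n : ℕ) : (sphere (Set.Iio (0 : ℤ)) Int.natAbs (n + 1) 0).ncard = 0 := by
  have h3 : sphere (Set.Iio (0 : ℤ)) Int.natAbs (n + 1) 0 = ∅ := by
    rw [Set.eq_empty_iff_forall_notMem]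
    rintro k ⟨h1, h2⟩
    have h4 : k 0 < 0 := h1 0
    rw [Finset.sum_eq_zero_iff] at h2
    have h5 := h2 0 (Finset.mem_univ 0)
    omega
  rw [h3, Set.ncard_empty]

/-- These are the compositions of `r + 1` into `n + 1` positive parts. -/
theorem neg_sphere (n r : ℕ) :
    (sphere (Set.Iio (0 : ℤ)) Int.natAbs (n + 1) (r + 1)).ncard = r.choose n := by
  induction r generalizing n with
  | zero =>
    rw [neg_sphere_succ, neg_sphere_zero]
    cases n with
    | zero => rw [ncard_sphere_zero_left_zero]; rfl
    | succ n => rw [neg_sphere_zero]; rfl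
  | succ r ih =>
    rw [neg_sphere_succ, ih]
    cases n with
    | zero => rw [ncard_sphere_zero_left_succ]; simp
    | succ n => rw [ih, Nat.choose_succ_succ', add_comm]

theorem neg_ball (n r : ℕ) :
    (ball (Set.Iio (0 : ℤ)) Int.natAbs (n + 1) r).ncard = r.choose (n + 1) := by
  induction r with
  | zero => rw [ball_zero, neg_sphere_zero]; rfl
  | succ r ih =>
    rw [ncard_ball_succ finite_natAbs_le, ih, neg_sphere, Nat.choose_succ_succ', add_comm]

end Numbers

/-! ### The three dimension polynomials and their comparison -/

section Assembly

variable {K : Type*} [Field K]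

theorem setOf_fin_prod {G : Type*} (p : G → Prop) :
    {t : Fin 4 × G | p t.2} = Set.univ ×ˢ {k | p k} := by
  ext t
  simp

theorem ncard_fin_prod {G : Type*} (p : G → Prop) :
    {t : Fin 4 × G | p t.2}.ncard = 4 * {k | p k}.ncard := by
  rw [setOf_fin_prod, Set.ncard_prod, Set.ncard_univ, Nat.card_eq_fintype_card, Fintype.card_fin]

theorem ncard_subtype {G : Type*} (q p : G → Prop) :
    {k : {k // q k} | p k.1}.ncard = {k | p k ∧ q k}.ncard := by
  rw [← Set.ncard_image_of_injective _ Subtype.val_injective]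
  congr 1
  ext k
  simp [and_comm]

/-! #### The differential system -/

theorem setOf_sum_le (r : ℕ) : {k : Fin 4 → ℕ | ∑ j, k j ≤ r} = ball Set.univ id 4 r := by
  ext k
  simp [ball]

theorem isDimensionPolynomial_derSym :
    IsDimensionPolynomial (filtrationDim Term.ord (solModule (derSym K)))
      differentialPolynomial := by
  have hfin4 : ∀ r, {k : Fin 4 → ℕ | ∑ j, k j ≤ r}.Finite := by
    intro r
    rw [setOf_sum_le]
    exact finite_ball (w := id) (fun r => Set.finite_Iic r) _ _ _
  have hfin : ∀ r, {t : Fin 4 × (Fin 4 → ℕ) | Term.ord t ≤ r}.Finite := by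
    intro r
    have h1 := setOf_fin_prod fun k : Fin 4 → ℕ => ∑ j, k j ≤ r
    simp only [Term.ord]
    rw [h1]
    exact Set.finite_univ.prod (hfin4 r)
  -- The count involves the ball of radius `r - 3`; writing `r = s + 3` avoids truncated
  -- subtraction.
  filter_upwards [eventually_ge_atTop 3] with r hr
  obtain ⟨s, rfl⟩ := Nat.exists_eq_add_of_le' hr
  obtain ⟨n, hn, hcount⟩ := filtrationDim_derSym (K := K) hfin (s + 3)
  refine ⟨n, hn, ?_⟩
  have h1 : {t : Fin 4 × (Fin 4 → ℕ) | Term.ord t ≤ s + 3}.ncard =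
      4 * (ball (Set.univ : Set ℕ) id 4 (s + 3)).ncard := by
    rw [← setOf_sum_le]
    exact ncard_fin_prod fun k : Fin 4 → ℕ => ∑ j, k j ≤ s + 3
  have h2 : {p : Fin 4 × (Fin 4 → ℕ) | Term.ord (p.1, p.2 + Pi.single 0 2) ≤ s + 3}.ncard =
      4 * (ball (Set.univ : Set ℕ) id 4 (s + 1)).ncard := by
    rw [← setOf_sum_le]
    simp only [Term.ord_add_single]
    exact (ncard_fin_prod fun k : Fin 4 → ℕ => ∑ j, k j + 2 ≤ s + 3).trans (by
      simp only [Nat.add_le_add_iff_right])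
  have h3 : {k : {k : Fin 4 → ℕ // k 0 ≤ 1} |
      Term.ord ((1 : Fin 4), k.1 + Pi.single 1 1) ≤ s + 3}.ncard +
      (ball (Set.univ : Set ℕ) id 4 s).ncard = (ball (Set.univ : Set ℕ) id 4 (s + 2)).ncard := by
    rw [← setOf_sum_le, ← setOf_sum_le]
    simp only [Term.ord_add_single]
    have h4 := ncard_subtype (fun k : Fin 4 → ℕ => k 0 ≤ 1) fun k => ∑ j, k j + 1 ≤ s + 3
    -- The exponents with `k 0 ≤ 1` are those outside the image of the shift by `2`, so they are
    -- counted as a difference of two balls.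
    have h5 := ncard_notMem_range_add (ord := fun k : Fin 4 → ℕ => ∑ j, k j)
      (lm := fun k : Fin 4 → ℕ => k + Pi.single 0 2) (add_left_injective _) hfin4 (s + 2)
    simp only [notMem_range_add_single_nat] at h5
    rw [h4, ← h5]
    congr 2
    · ext k
      simp only [Set.mem_ofPred_eq]
      omega
    · ext k
      have h6 := Term.ord_add_single k 0 0 2
      change ∑ j, (k + Pi.single 0 2 : Fin 4 → ℕ) j = _ at h6
      rw [Set.mem_ofPred_eq, Set.mem_ofPred_eq, h6]
      omega
  rw [h1, h2] at hcount
  have h3' := congrArg (Nat.cast : ℕ → ℚ) h3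
  have hcount' := congrArg (Nat.cast : ℕ → ℚ) hcount
  push_cast [nat_ball_four] at h3' hcount'
  rw [differentialPolynomial]
  simp only [Polynomial.eval_add, Polynomial.eval_mul, Polynomial.eval_pow, Polynomial.eval_X,
    Polynomial.eval_C, Polynomial.eval_ofNat]
  push_cast
  linear_combination hcount' - h3'

/-! #### The symmetric scheme -/

theorem setOf_size_le (r : ℕ) : {k | size k ≤ r} = ball Set.univ Int.natAbs 4 r := by
  ext k
  simp [ball, size]

theorem finite_size_le (r : ℕ) : {k | size k ≤ r}.Finite := by
  rw [setOf_size_le]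
  exact finite_ball finite_natAbs_le _ _ _

theorem finite_term_size_le (r : ℕ) : {t : Fin 4 × (Fin 4 → ℤ) | size t.2 ≤ r}.Finite := by
  rw [setOf_fin_prod fun k => size k ≤ r]
  exact Set.finite_univ.prod (finite_size_le r)

theorem ncard_size_le (r : ℕ) :
    ({k | size k ≤ r}.ncard : ℚ) = 1 + 2 / 3 * r ^ 2 * (r + 1) ^ 2 + 8 / 3 * r * (r + 1) := by
  rw [setOf_size_le, int_ball_four]

theorem isDimensionPolynomial_symmetricSym [CharZero K] :
    IsDimensionPolynomial (filtrationDim (InvTerm.ord (m := 4) (s := 4))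
      (solModule (symmetricSym K))) symmetricPolynomial := by
  filter_upwards [eventually_ge_atTop 3] with r hr
  obtain ⟨s, rfl⟩ := Nat.exists_eq_add_of_le' hr
  obtain ⟨n, hn, hcount⟩ := filtrationDim_symmetricSym (K := K) finite_term_size_le (s + 3)
  refine ⟨n, hn, ?_⟩
  have hout : ∀ k, size (outward 0 2 k) = size k + 2 := size_outward 0 2
  have hout' : ∀ k, size (outward 1 1 k) = size k + 1 := size_outward 1 1
  have h3 : {k : {k : Fin 4 → ℤ // -2 ≤ k 0 ∧ k 0 ≤ 1} | size (outward 1 1 k.1) ≤ s + 3}.ncard +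
      {k | size k ≤ s}.ncard = {k | size k ≤ s + 2}.ncard := by
    have h4 := ncard_subtype (fun k : Fin 4 → ℤ => -2 ≤ k 0 ∧ k 0 ≤ 1)
      fun k => size (outward 1 1 k) ≤ s + 3
    have h5 := ncard_notMem_range_add (ord := size) (lm := outward 0 2)
      (outward_injective 0 2) finite_size_le (s + 2)
    simp only [notMem_range_outward] at h5
    rw [h4, ← h5]
    simp only [hout, hout', Nat.add_le_add_iff_right]
  rw [ncard_fin_prod fun k => size k ≤ s + 3,
    ncard_fin_prod fun k => size (outward 0 2 k) ≤ s + 3] at hcount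
  simp only [hout, Nat.reduceLeDiff] at hcount
  have h3' := congrArg (Nat.cast : ℕ → ℚ) h3
  have hcount' := congrArg (Nat.cast : ℕ → ℚ) hcount
  push_cast [ncard_size_le] at h3' hcount'
  rw [symmetricPolynomial]
  simp only [Polynomial.eval_add, Polynomial.eval_sub, Polynomial.eval_mul, Polynomial.eval_pow,
    Polynomial.eval_X, Polynomial.eval_ofNat]
  push_cast
  linear_combination hcount' - h3'

/-! #### The forward scheme -/

theorem setOf_neg_size_le (r : ℕ) :
    {k | (∀ l, k l < 0) ∧ size k ≤ r} = ball (Set.Iio 0) Int.natAbs 4 r := by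
  ext k
  simp [ball, size]

theorem size_boxLead (k : Fin 4 → ℤ) :
    size (boxLead k) = size k + if ∀ l, k l < 0 then 0 else 2 := by
  unfold boxLead
  split_ifs with h1 h2 h2
  · exact absurd (h2 _) (not_lt.2 h1)
  · have := size_add_single k (firstNonneg k) 2
    omega
  · rfl
  · exact absurd (neg_of_firstNonneg_neg (not_le.1 h1)) h2

/-- Inclusion and exclusion: either `k` lies in the ball of radius `r`, or all its entries are
negative and radius `r + 2` suffices. -/
theorem ncard_size_boxLead_le (r : ℕ) :
    {k | size (boxLead k) ≤ r + 2}.ncard + r.choose 4 =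
      {k | size k ≤ r}.ncard + (r + 2).choose 4 := by
  rw [← neg_ball, ← neg_ball, ← setOf_neg_size_le, ← setOf_neg_size_le]
  have h1 : {k | size (boxLead k) ≤ r + 2} =
      {k | size k ≤ r} ∪ {k | (∀ l, k l < 0) ∧ size k ≤ r + 2} := by
    ext k
    simp only [size_boxLead, Set.mem_union, Set.mem_ofPred_eq]
    by_cases h : ∀ l, k l < 0
    · simp only [eq_true h, if_true, true_and]
      omega
    · simp only [eq_false h, if_false, false_and, or_false]
      omega
  have h2 : {k | (∀ l, k l < 0) ∧ size k ≤ r} =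
      {k | size k ≤ r} ∩ {k | (∀ l, k l < 0) ∧ size k ≤ r + 2} := by
    ext k
    simp only [Set.mem_inter_iff, Set.mem_ofPred_eq]
    constructor
    · rintro ⟨h3, h4⟩
      exact ⟨h4, h3, by omega⟩
    · rintro ⟨h4, h3, _⟩
      exact ⟨h3, h4⟩
  rw [h1, h2]
  exact Set.ncard_union_add_ncard_inter _ _ (finite_size_le r)
    ((finite_size_le (r + 2)).subset fun k hk => hk.2)

theorem size_insertNth (j : Fin 4) (a : ℤ) (k : Fin 3 → ℤ) :
    size (j.insertNth a k : Fin 4 → ℤ) = a.natAbs + ∑ i, (k i).natAbs := by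
  rw [size, Fin.sum_univ_succAbove _ j]
  simp

theorem firstNonneg_insertNth {j : Fin 4} {k : Fin 3 → ℤ} (hk : ∀ i, k i < 0) :
    firstNonneg (j.insertNth (1 : ℤ) k : Fin 4 → ℤ) = j := by
  refine firstNonneg_eq (fun l hl => ?_) (by simp)
  obtain ⟨i, rfl⟩ := Fin.exists_succAbove_eq hl.ne
  simpa using hk i

/-- There are four places for the entry `1`, and the other three entries are negative of total size
`r + 1`. -/
theorem ncard_isExceptional (r : ℕ) :
    {k | IsExceptional k ∧ size k = r + 2}.ncard = 4 * r.choose 2 := by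
  have h1 : {k | IsExceptional k ∧ size k = r + 2} =
      (fun p : Fin 4 × (Fin 3 → ℤ) => (p.1.insertNth (1 : ℤ) p.2 : Fin 4 → ℤ)) ''
        {p | p.2 ∈ sphere (Set.Iio 0) Int.natAbs 3 (r + 1)} := by
    ext k
    simp only [Set.mem_image, Set.mem_ofPred_eq]
    constructor
    · rintro ⟨hex, hk⟩
      have h2 : (firstNonneg k).insertNth (1 : ℤ) (Fin.removeNth (firstNonneg k) k) = k := by
        rw [← hex.1]
        exact Fin.insertNth_self_removeNth _ _
      refine ⟨(firstNonneg k, Fin.removeNth (firstNonneg k) k), ⟨fun i => ?_, ?_⟩, h2⟩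
      · exact hex.neg (Fin.succAbove_ne _ _)
      · rw [← h2, size_insertNth] at hk
        simp only [Int.natAbs_one] at hk
        simp only
        omega
    · rintro ⟨⟨j, l⟩, ⟨hneg, hl⟩, rfl⟩
      simp only at hneg hl ⊢
      have h3 : firstNonneg (j.insertNth (1 : ℤ) l : Fin 4 → ℤ) = j := firstNonneg_insertNth hneg
      refine ⟨⟨?_, ?_⟩, ?_⟩
      · rw [h3, Fin.insertNth_apply_same]
      · rw [h3]
        refine lastNonneg_eq (fun i hi => ?_) (by simp)
        obtain ⟨i', rfl⟩ := Fin.exists_succAbove_eq hi.ne'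
        simpa using hneg i'
      · rw [size_insertNth, hl, Int.natAbs_one]
        omega
  have h4 : Set.InjOn (fun p : Fin 4 × (Fin 3 → ℤ) => (p.1.insertNth (1 : ℤ) p.2 : Fin 4 → ℤ))
      {p | p.2 ∈ sphere (Set.Iio 0) Int.natAbs 3 (r + 1)} := by
    rintro ⟨j, l⟩ ⟨hl, _⟩ ⟨j', l'⟩ ⟨hl', _⟩ h
    simp only at h hl hl'
    have h5 : j = j' := by
      rw [← firstNonneg_insertNth (j := j) hl, h, firstNonneg_insertNth hl']
    subst h5
    rw [Fin.insertNth_right_injective _ h]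
  rw [h1, h4.ncard_image,
    ncard_fin_prod fun k => k ∈ sphere (Set.Iio 0) Int.natAbs 3 (r + 1)]
  congr 1
  exact neg_sphere 2 r

/-- Regular exponents need size at most `r + 1`, exceptional ones at most `r + 2`. So the count is
that of all exponents of size at most `r + 1` outside the range of `boxLead`, plus the exceptional
ones of size exactly `r + 2`. -/
theorem ncard_fwdLead_le (r : ℕ) :
    {k : {k : Fin 4 → ℤ // 0 ≤ k (firstNonneg k) ∧ k (firstNonneg k) ≤ 1} |
      size (fwdLead k.1).2 ≤ r + 2}.ncard + {k | size (boxLead k) ≤ r + 1}.ncard =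
      {k | size k ≤ r + 1}.ncard + 4 * r.choose 2 := by
  rw [ncard_subtype (fun k : Fin 4 → ℤ => 0 ≤ k (firstNonneg k) ∧ k (firstNonneg k) ≤ 1)
    fun k => size (fwdLead k).2 ≤ r + 2, ← ncard_isExceptional,
    ← ncard_notMem_range_add (ord := size) boxLead_injective finite_size_le, add_right_comm]
  congr 1
  simp only [notMem_range_boxLead]
  rw [← Set.ncard_union_eq ?_ ((finite_size_le (r + 1)).subset fun k hk => hk.1)
    ((finite_size_le (r + 2)).subset fun k hk => hk.2.le)]
  · congr 1
    ext k
    simp only [Set.mem_union, Set.mem_ofPred_eq]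
    constructor
    · rintro ⟨h1, h2⟩
      rw [size_fwdLead h2.1] at h1
      split_ifs at h1 with h3
      · by_cases h4 : size k = r + 2
        · exact Or.inr ⟨h3, h4⟩
        · exact Or.inl ⟨by omega, h2⟩
      · exact Or.inl ⟨by omega, h2⟩
    · rintro (⟨h1, h2⟩ | ⟨h1, h2⟩)
      · rw [size_fwdLead h2.1]
        refine ⟨?_, h2⟩
        split_ifs <;> omega
      · have h3 := h1.1
        rw [size_fwdLead (by omega), if_pos h1]
        omega
  · rw [Set.disjoint_left]
    rintro k ⟨h1, _⟩ ⟨_, h2⟩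
    omega

theorem cast_choose_four (r : ℕ) :
    (r.choose 4 : ℚ) = r * (r - 1) * (r - 2) * (r - 3) / 24 := by
  rw [Nat.cast_choose_eq_descPochhammer_div]
  simp [descPochhammer, Nat.factorial]
  ring

/-- For order at most `r` there are `b(r) = B(r-2) + C(r,4) - C(r-2,4)` relations for each `□ e_i`,
and `B(r-1) - b(r-1) + 4C(r-2,2)` relations coming from `w`. -/
theorem isDimensionPolynomial_forwardSym [CharZero K] :
    IsDimensionPolynomial (filtrationDim (InvTerm.ord (m := 4) (s := 4))
      (solModule (forwardSym K))) forwardPolynomial := by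
  filter_upwards [eventually_ge_atTop 3] with r hr
  obtain ⟨s, rfl⟩ := Nat.exists_eq_add_of_le' hr
  obtain ⟨n, hn, hcount⟩ := filtrationDim_forwardSym (K := K) finite_term_size_le (s + 3)
  refine ⟨n, hn, ?_⟩
  rw [ncard_fin_prod fun k => size k ≤ s + 3,
    ncard_fin_prod fun k => size (boxLead k) ≤ s + 3] at hcount
  have h1 := congrArg (Nat.cast : ℕ → ℚ) (ncard_size_boxLead_le (s + 1))
  have h2 := congrArg (Nat.cast : ℕ → ℚ) (ncard_size_boxLead_le s)
  have h3 := congrArg (Nat.cast : ℕ → ℚ) (ncard_fwdLead_le (s + 1))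
  have hcount' := congrArg (Nat.cast : ℕ → ℚ) hcount
  simp only [add_assoc, Nat.reduceAdd] at h1 h2 h3
  push_cast [ncard_size_le, cast_choose_four, Nat.cast_choose_two] at h1 h2 h3 hcount'
  rw [forwardPolynomial]
  simp only [Polynomial.eval_add, Polynomial.eval_sub, Polynomial.eval_mul, Polynomial.eval_pow,
    Polynomial.eval_X, Polynomial.eval_C, Polynomial.eval_ofNat]
  push_cast
  linear_combination hcount' - 4 * h1 + h2 - h3

theorem hasHigherStrength_of_isDimensionPolynomial {f g : ℕ → Cardinal} {φ ψ : Polynomial ℚ}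
    (hf : IsDimensionPolynomial f forwardPolynomial)
    (hg : IsDimensionPolynomial g symmetricPolynomial) (hφ : IsDimensionPolynomial f φ)
    (hψ : IsDimensionPolynomial g ψ) : HasHigherStrength φ ψ := by
  filter_upwards [hf, hg, hφ, hψ, eventually_ge_atTop 4] with r h1 h2 h3 h4 hr
  obtain ⟨a, ha, ha'⟩ := h1
  obtain ⟨b, hb, hb'⟩ := h2
  obtain ⟨c, hc, hc'⟩ := h3
  obtain ⟨d, hd, hd'⟩ := h4
  have hac : a = c := Nat.cast_injective (ha.symm.trans hc)
  have hbd : b = d := Nat.cast_injective (hb.symm.trans hd)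
  rw [← hc', ← hd', ← hac, ← hbd, ha', hb', forwardPolynomial, symmetricPolynomial]
  simp only [Polynomial.eval_add, Polynomial.eval_sub, Polynomial.eval_mul, Polynomial.eval_pow,
    Polynomial.eval_X, Polynomial.eval_C, Polynomial.eval_ofNat]
  -- The difference of the two polynomials, `r³ - (9/2)r² + (5/2)r + 6`, vanishes at `r = 3`.
  -- Expanded in `s = r - 4` it has only positive coefficients.
  obtain ⟨s, rfl⟩ := Nat.exists_eq_add_of_le hr
  push_cast
  have hs : (0 : ℚ) ≤ s := Nat.cast_nonneg s
  have : 0 < (s : ℚ) ^ 3 + 15 / 2 * s ^ 2 + 29 / 2 * s + 8 := by positivity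
  linarith

end Assembly

end PotentialStrength

theorem mainTheorem3 (K : Type*) [Field K] [CharZero K] :
    (∀ δ : Fin 4 → Derivation ℤ K K, (∀ i j a, δ i (δ j a) = δ j (δ i a)) →
      PotentialStrength.IsDimensionPolynomialOfSystem PotentialStrength.Term.ord
        (PotentialStrength.differentialSubmodule δ) (PotentialStrength.differentialIdeal δ)
        PotentialStrength.differentialPolynomial) ∧
    (∀ σ : Fin 4 → K ≃+* K, (∀ i j a, σ i (σ j a) = σ j (σ i a)) →
      PotentialStrength.IsDimensionPolynomialOfSystem PotentialStrength.InvTerm.ord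
        (PotentialStrength.forwardSubmodule σ) (PotentialStrength.forwardIdeal σ)
        PotentialStrength.forwardPolynomial ∧
      PotentialStrength.IsDimensionPolynomialOfSystem PotentialStrength.InvTerm.ord
        (PotentialStrength.symmetricSubmodule σ) (PotentialStrength.symmetricIdeal σ)
        PotentialStrength.symmetricPolynomial ∧
      ∀ φ ψ : Polynomial ℚ,
        PotentialStrength.IsDimensionPolynomialOfSystem PotentialStrength.InvTerm.ord
          (PotentialStrength.forwardSubmodule σ) (PotentialStrength.forwardIdeal σ) φ →
        PotentialStrength.IsDimensionPolynomialOfSystem PotentialStrength.InvTerm.ord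
          (PotentialStrength.symmetricSubmodule σ) (PotentialStrength.symmetricIdeal σ) ψ →
        PotentialStrength.HasHigherStrength φ ψ) := by
  refine ⟨fun δ _ => ?_, fun σ _ => ?_⟩
  · rw [PotentialStrength.differentialIdeal_eq, PotentialStrength.differentialSubmodule_eq]
    exact PotentialStrength.isDimensionPolynomialOfSystem_span_linForm
      PotentialStrength.isDimensionPolynomial_derSym
  · have hf := PotentialStrength.isDimensionPolynomial_forwardSym (K := K)
    have hs := PotentialStrength.isDimensionPolynomial_symmetricSym (K := K)
    rw [PotentialStrength.forwardIdeal_eq, PotentialStrength.symmetricIdeal_eq,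
      PotentialStrength.forwardSubmodule_eq, PotentialStrength.symmetricSubmodule_eq]
    exact ⟨PotentialStrength.isDimensionPolynomialOfSystem_span_linForm hf,
      PotentialStrength.isDimensionPolynomialOfSystem_span_linForm hs, fun φ ψ hφ hψ =>
        PotentialStrength.hasHigherStrength_of_isDimensionPolynomial hf hs hφ.dim hψ.dim⟩
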